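/- Let $K$ be a field. **Triangular algebras.** Let $Q$ be a finite quiver. For an arrow or path $p$ write $h(p)$ for the vertex where it starts and $t(p)$ for the vertex where it ends; paths are composed from left to right, and two paths are parallel if they have the same start and the same end. A triangular algebra is a quotient $\Lambda=KQ/I$, where $Q$ is a finite quiver without oriented cycles and $I$ is an ideal of the path algebra $KQ$ generated by linear combinations of parallel paths of lengths at least $2$; a $K$-algebra is also called triangular if it is isomorphic to such a quotient. The Cartan matrix $C$ of a finite-dimensional $K$-algebra $A$ has entries $C_{ij}=\dim_K\operatorname{Hom}_A(P_i,P_j)$, where $P_1,\dots,P_n$ is a complete collection of pairwise non-isomorphic indecomposable finitely generated projective right $A$-modules. If $A$ is triangular, its Coxeter polynomial is $\phi_A(x)=\det(xC+C^T)\in\mathbb Z[x]$ (equal to $1$ for the zero algebra, the case of the empty quiver). For a vertex $v$ of $Q$ with corresponding idempotent $e_v\in\Lambda$ put $\Lambda^-=(1-e_v)\Lambda(1-e_v)$. **Insertion.** Let $S$ be a nonempty finite poset with sets $S_{\min}$, $S_{\max}$ of minimal and of maximal elements, and with Hasse quiver $Q_S$ (vertices the elements of $S$, one arrow $x\to y$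 whenever $y$ covers $x$). The insertion $\Lambda\xleftarrow{v}S$ is the algebra $K\widetilde Q/\widetilde I$ defined as follows. The vertices of $\widetilde Q$ are the vertices of $Q$ different from $v$ and the elements of $S$. Its arrows are: the arrows of $Q$ neither starting nor ending at $v$; the arrows of $Q_S$; an arrow $(\alpha,s)$ from $h(\alpha)$ to $s$ for each arrow $\alpha$ of $Q$ ending at $v$ and each $s\in S_{\min}$; an arrow $(s,\beta)$ from $s$ to $t(\beta)$ for each arrow $\beta$ of $Q$ starting at $v$ and each $s\in S_{\max}$. For a nontrivial path $p$ of $Q$ ending at $v$ and $s\in S_{\min}$ let $(p,s)$ be the path obtained by replacing the last arrow $\alpha$ of $p$ by $(\alpha,s)$; for a nontrivial path $p$ starting at $v$ and $s\in S_{\max}$ let $(s,p)$ be the path obtained by replacing the first arrow $\beta$ of $p$ by $(s,\beta)$. A maximal path of $Q_S$ is a path from an element of $S_{\min}$ to an element of $S_{\max}$. For a path $p$ of $Q$ which neither starts nor ends at $v$ put $\widetilde p=p$ if $p$ does not pass through $v$, and $\widetilde p=(p',h(q))\,q\,(t(q),p'')$ if $p=p'p''$ with $t(p')=h(p'')=v$,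 where $q$ is a maximal path of $Q_S$ (its choice does not affect the ideal that follows). The ideal $\widetilde I$ is generated by: 1. $\sum c_p\,(p,s)$ for $s\in S_{\min}$ and every linear combination $\sum c_p\,p\in I$ of parallel paths ending at $v$; and $\sum c_p\,(s,p)$ for $s\in S_{\max}$ and every linear combination $\sum c_p\,p\in I$ of parallel paths starting at $v$; 2. $q'-q''$ for parallel paths $q',q''$ of $Q_S$; for arrows $\alpha,\beta$ of $Q$ with $t(\alpha)=v$, $h(\beta)=v$ and paths $q',q''$ of $Q_S$: $(\alpha,h(q'))q'-(\alpha,h(q''))q''$ whenever $h(q'),h(q'')\in S_{\min}$ and $t(q')=t(q'')$; $q'(t(q'),\beta)-q''(t(q''),\beta)$ whenever $t(q'),t(q'')\in S_{\max}$ and $h(q')=h(q'')$; and $(\alpha,h(q'))q'(t(q'),\beta)-(\alpha,h(q''))q''(t(q''),\beta)$ whenever $q',q''$ are maximal; 3. $\sum c_p\,\widetilde p$ for every linear combination $\sum c_p\,p\in I$ of parallel paths that neither start nor end at $v$. **Proposition.** Let $\Lambda=KQ/I$ be a triangular algebra and let $v$ be any vertex of $Q$. For $i\ge1$ let $\overrightarrow{A_i}$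 be the chain with $i$ elements. Then $\Lambda\xleftarrow{v}\overrightarrow{A_1}\simeq\Lambda$ as $K$-algebras. Put $\Lambda_0=\Lambda^-$, $\Lambda_1=\Lambda$ and $\Lambda_i=\Lambda\xleftarrow{v}\overrightarrow{A_i}$ for $i\ge2$. Then every $\Lambda_i$ $(i\ge0)$ is a triangular algebra, and - $\deg\phi_{\Lambda_{i+1}}=\deg\phi_{\Lambda_i}+1$ for all $i\ge0$; - $\phi_{\Lambda_{i+1}}(x)=(x+1)\,\phi_{\Lambda_i}(x)-x\,\phi_{\Lambda_{i-1}}(x)$ for all $i\ge1$. -/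

import Mathlib

open CategoryTheory Polynomial

universe u w s

namespace TriangularAlgebra

/-! ### The Coxeter polynomial of a finite-dimensional algebra -/

section Coxeter

/-- The finitely generated indecomposable projective right modules over `A`
(a right `A`-module is a left module over the opposite ring). -/
def IndecProj (A : Type u) [Ring A] : Type (u + 1) :=
  {P : ModuleCat.{u} Aᵐᵒᵖ //
    Module.Finite Aᵐᵒᵖ P ∧ Module.Projective Aᵐᵒᵖ P ∧ Indecomposable P}

/-- Isomorphism of indecomposable projective modules. -/
instance indecProjSetoid (A : Type u) [Ring A] : Setoid (IndecProj A) where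
  r P P' := Nonempty (P.1 ≅ P'.1)
  iseqv :=
    { refl := fun P => ⟨Iso.refl P.1⟩
      symm := fun ⟨f⟩ => ⟨f.symm⟩
      trans := fun ⟨f⟩ ⟨g⟩ => ⟨f.trans g⟩ }

/-- The isomorphism classes of indecomposable projective right `A`-modules. -/
def IndecProjClass (A : Type u) [Ring A] : Type (u + 1) :=
  Quotient (indecProjSetoid A)

/-- A representative of an isomorphism class of indecomposable projective modules. -/
noncomputable def IndecProjClass.rep {A : Type u} [Ring A] (i : IndecProjClass A) :
    ModuleCat.{u} Aᵐᵒᵖ :=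
  (Quotient.out i).1

/-- The Cartan matrix of a finite-dimensional `K`-algebra `A`: its entries are the numbers
`dim_K Hom_A(P i, P j)`, where the `P i` form a complete collection of pairwise non-isomorphic
indecomposable projective right modules. -/
noncomputable def cartanMatrix (K : Type w) [Field K] (A : Type u) [Ring A] [Algebra K A] :
    Matrix (IndecProjClass A) (IndecProjClass A) ℤ :=
  fun i j => (Module.finrank K (i.rep ⟶ j.rep) : ℤ)

open Classical in
/-- The Coxeter polynomial `det (x C + Cᵀ)` of a finite-dimensional `K`-algebra `A` with Cartan
matrix `C` (of determinant one, as is the case for triangular algebras).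
A finite-dimensional algebra has only finitely many indecomposable projective modules up to
isomorphism, so the value `0` in the other case is irrelevant. -/
noncomputable def coxeterPolynomial (K : Type w) [Field K] (A : Type u) [Ring A] [Algebra K A] :
    ℤ[X] :=
  if h : Finite (IndecProjClass A) then
    letI : Fintype (IndecProjClass A) := @Fintype.ofFinite _ h
    (((X : ℤ[X]) • (cartanMatrix K A).map (Polynomial.C : ℤ →+* ℤ[X])) +
      ((cartanMatrix K A).map (Polynomial.C : ℤ →+* ℤ[X])).transpose).det
  else 0

end Coxeter

/-! ### Path algebras -/

section PathAlgebra

/-- The path algebra `KQ` of a quiver `Q`: the vector space with basis the set of all paths,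
an element being given by its components, which are finite linear combinations of paths
from `a` to `b`, for all pairs `(a, b)` of vertices. -/
def PathAlgebra (K : Type s) [Field K] (Q : Type u) [Quiver.{w} Q] : Type (max u w s) :=
  ∀ a b : Q, Quiver.Path a b →₀ K

variable {K : Type s} [Field K] {Q : Type u} [Quiver.{w} Q]

namespace PathAlgebra

noncomputable instance instAddCommGroup : AddCommGroup (PathAlgebra K Q) :=
  inferInstanceAs (AddCommGroup (∀ a b : Q, Quiver.Path a b →₀ K))

noncomputable instance : Module K (PathAlgebra K Q) :=
  inferInstanceAs (Module K (∀ a b : Q, Quiver.Path a b →₀ K))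

/-- The bilinear extension of the composition of paths
(first the left factor, then the right factor). -/
noncomputable def concat {a b c : Q} (x : Quiver.Path a b →₀ K) (y : Quiver.Path b c →₀ K) :
    Quiver.Path a c →₀ K :=
  x.sum fun p k => y.sum fun q l => Finsupp.single (p.comp q) (k * l)

open Classical in
/-- A linear combination of parallel paths, as an element of the path algebra. -/
noncomputable def of {a b : Q} (x : Quiver.Path a b →₀ K) : PathAlgebra K Q :=
  Pi.single a (Pi.single b x)

/-- A path, as an element of the path algebra. -/
noncomputable def ofPath {a b : Q} (p : Quiver.Path a b) : PathAlgebra K Q :=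
  of (Finsupp.single p 1)

/-- The idempotent given by the trivial path at a vertex. -/
noncomputable def vertexIdem (v : Q) : PathAlgebra K Q :=
  ofPath (Quiver.Path.nil : Quiver.Path v v)

theorem concat_eq {a b c : Q} (x : Quiver.Path a b →₀ K) (y : Quiver.Path b c →₀ K) :
    concat x y = CategoryStruct.comp (obj := Free K (Paths Q)) (X := a) (Y := b) (Z := c) x y :=
  rfl

theorem concat_zero {a b c : Q} (x : Quiver.Path a b →₀ K) :
    concat x (0 : Quiver.Path b c →₀ K) = 0 := by
  simp [concat]

theorem zero_concat {a b c : Q} (y : Quiver.Path b c →₀ K) :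
    concat (0 : Quiver.Path a b →₀ K) y = 0 := by
  simp [concat]

theorem concat_add {a b c : Q} (x : Quiver.Path a b →₀ K) (y z : Quiver.Path b c →₀ K) :
    concat x (y + z) = concat x y + concat x z :=
  Preadditive.comp_add (C := Free K (Paths Q)) a b c x y z

theorem add_concat {a b c : Q} (x y : Quiver.Path a b →₀ K) (z : Quiver.Path b c →₀ K) :
    concat (x + y) z = concat x z + concat y z :=
  Preadditive.add_comp (C := Free K (Paths Q)) a b c x y z

theorem smul_concat {a b c : Q} (k : K) (x : Quiver.Path a b →₀ K) (y : Quiver.Path b c →₀ K) :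
    concat (k • x) y = k • concat x y :=
  Linear.smul_comp (R := K) (C := Free K (Paths Q)) a b c k x y

theorem concat_smul {a b c : Q} (k : K) (x : Quiver.Path a b →₀ K) (y : Quiver.Path b c →₀ K) :
    concat x (k • y) = k • concat x y :=
  Linear.comp_smul (R := K) (C := Free K (Paths Q)) a b c x k y

theorem concat_assoc {a b c d : Q} (x : Quiver.Path a b →₀ K) (y : Quiver.Path b c →₀ K)
    (z : Quiver.Path c d →₀ K) : concat (concat x y) z = concat x (concat y z) :=
  Category.assoc (obj := Free K (Paths Q)) (W := a) (X := b) (Y := c) (Z := d) x y z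

theorem nil_concat {a b : Q} (x : Quiver.Path a b →₀ K) :
    concat (Finsupp.single Quiver.Path.nil 1) x = x :=
  Category.id_comp (obj := Free K (Paths Q)) (X := a) (Y := b) x

theorem concat_nil {a b : Q} (x : Quiver.Path a b →₀ K) :
    concat x (Finsupp.single Quiver.Path.nil 1) = x :=
  Category.comp_id (obj := Free K (Paths Q)) (X := a) (Y := b) x

theorem sum_concat {ι : Type*} (t : Finset ι) {a b c : Q} (x : ι → (Quiver.Path a b →₀ K))
    (y : Quiver.Path b c →₀ K) : concat (∑ i ∈ t, x i) y = ∑ i ∈ t, concat (x i) y :=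
  map_sum (AddMonoidHom.mk' (fun x => concat x y) fun x x' => add_concat x x' y) x t

theorem concat_sum {ι : Type*} (t : Finset ι) {a b c : Q} (x : Quiver.Path a b →₀ K)
    (y : ι → (Quiver.Path b c →₀ K)) : concat x (∑ i ∈ t, y i) = ∑ i ∈ t, concat x (y i) :=
  map_sum (AddMonoidHom.mk' (fun y => concat x y) fun y y' => concat_add x y y') y t

theorem add_apply (x y : PathAlgebra K Q) (a c : Q) : (x + y) a c = x a c + y a c := rfl

theorem zero_apply (a c : Q) : (0 : PathAlgebra K Q) a c = 0 := rfl

theorem smul_apply (k : K) (x : PathAlgebra K Q) (a c : Q) : (k • x) a c = k • x a c := rfl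

variable [Fintype Q]

noncomputable instance : Mul (PathAlgebra K Q) where
  mul x y := fun a c => ∑ b : Q, concat (x a b) (y b c)

/-- The unit is the sum of all trivial paths. -/
noncomputable instance : One (PathAlgebra K Q) where
  one := ∑ v : Q, vertexIdem v

theorem mul_apply (x y : PathAlgebra K Q) (a c : Q) :
    (x * y) a c = ∑ b : Q, concat (x a b) (y b c) := rfl

theorem one_apply_self (a : Q) :
    (1 : PathAlgebra K Q) a a = Finsupp.single Quiver.Path.nil 1 := by
  classical
  change (∑ v : Q, vertexIdem v : PathAlgebra K Q) a a = _
  have h : (∑ v : Q, vertexIdem v : PathAlgebra K Q) a a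
      = ∑ v : Q, (vertexIdem v : PathAlgebra K Q) a a := by
    erw [Finset.sum_apply, Finset.sum_apply]
  rw [h, Finset.sum_eq_single a]
  · simp [vertexIdem, ofPath, of]
  · intro b _ hb
    simp [vertexIdem, ofPath, of, Pi.single_eq_of_ne hb.symm]
  · simp

theorem one_apply_ne {a b : Q} (hab : a ≠ b) : (1 : PathAlgebra K Q) a b = 0 := by
  classical
  change (∑ v : Q, vertexIdem v : PathAlgebra K Q) a b = _
  have h : (∑ v : Q, vertexIdem v : PathAlgebra K Q) a b
      = ∑ v : Q, (vertexIdem v : PathAlgebra K Q) a b := by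
    erw [Finset.sum_apply, Finset.sum_apply]
  rw [h]
  refine Finset.sum_eq_zero fun v _ => ?_
  by_cases hv : a = v
  · subst hv
    simp [vertexIdem, ofPath, of, Pi.single_eq_of_ne hab.symm]
  · simp [vertexIdem, ofPath, of, Pi.single_eq_of_ne hv]

noncomputable instance : Ring (PathAlgebra K Q) where
  __ := instAddCommGroup
  left_distrib x y z := by
    funext a c
    simp only [mul_apply, add_apply, concat_add, Finset.sum_add_distrib]
  right_distrib x y z := by
    funext a c
    simp only [mul_apply, add_apply, add_concat, Finset.sum_add_distrib]
  zero_mul x := by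
    funext a c
    simp only [mul_apply, zero_apply, zero_concat, Finset.sum_const_zero]
  mul_zero x := by
    funext a c
    simp only [mul_apply, zero_apply, concat_zero, Finset.sum_const_zero]
  mul_assoc x y z := by
    funext a d
    simp only [mul_apply, sum_concat, concat_sum, concat_assoc]
    exact Finset.sum_comm
  one_mul x := by
    classical
    funext a c
    rw [mul_apply, Finset.sum_eq_single a]
    · rw [one_apply_self, nil_concat]
    · intro b _ hb
      rw [one_apply_ne hb.symm, zero_concat]
    · simp
  mul_one x := by
    classical
    funext a c
    rw [mul_apply, Finset.sum_eq_single c]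
    · rw [one_apply_self, concat_nil]
    · intro b _ hb
      rw [one_apply_ne hb, concat_zero]
    · simp

noncomputable instance : Algebra K (PathAlgebra K Q) :=
  Algebra.ofModule
    (fun k x y => by
      funext a c
      simp only [mul_apply, smul_apply, smul_concat, Finset.smul_sum])
    (fun k x y => by
      funext a c
      simp only [mul_apply, smul_apply, concat_smul, Finset.smul_sum])

theorem vertexIdem_mul_self (v : Q) :
    (vertexIdem v * vertexIdem v : PathAlgebra K Q) = vertexIdem v := by
  classical
  funext a c
  rw [mul_apply, Finset.sum_eq_single v]
  · by_cases ha : a = v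
    · subst ha
      by_cases hc : c = a
      · subst hc
        have h : (vertexIdem c : PathAlgebra K Q) c c = Finsupp.single Quiver.Path.nil 1 := by
          simp [vertexIdem, ofPath, of]
        rw [h, nil_concat]
      · have h : (vertexIdem a : PathAlgebra K Q) a c = 0 := by
          simp [vertexIdem, ofPath, of, Pi.single_eq_of_ne hc]
        rw [h, concat_zero]
    · have h : ∀ b, (vertexIdem v : PathAlgebra K Q) a b = 0 := by
        intro b
        simp [vertexIdem, ofPath, of, Pi.single_eq_of_ne ha]
      rw [h, h, zero_concat]
  · intro b _ hb
    have h : (vertexIdem v : PathAlgebra K Q) b c = 0 := by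
      simp [vertexIdem, ofPath, of, Pi.single_eq_of_ne hb]
    rw [h, concat_zero]
  · simp

end PathAlgebra

end PathAlgebra

/-! ### Triangular algebras -/

section Triangular

/-- A quiver without oriented cycles: every closed path is trivial. -/
def IsAcyclic (Q : Type u) [Quiver.{w} Q] : Prop :=
  ∀ (a : Q) (p : Quiver.Path a a), p = Quiver.Path.nil

/-- The ideal `I` of `KQ` is generated by linear combinations of parallel paths
of lengths at least `2`. -/
def IsRelationIdeal {K : Type s} [Field K] {Q : Type u} [Quiver.{w} Q] [Fintype Q]
    (I : TwoSidedIdeal (PathAlgebra K Q)) : Prop :=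
  ∃ R : Set (PathAlgebra K Q),
    (∀ r ∈ R, ∃ (a b : Q) (x : Quiver.Path a b →₀ K),
      (∀ p ∈ x.support, 2 ≤ p.length) ∧ r = PathAlgebra.of x) ∧
    I = TwoSidedIdeal.span R

/-- The quotient algebra `KQ/I`. -/
abbrev QuotAlg {K : Type s} [Field K] {Q : Type u} [Quiver.{w} Q] [Fintype Q]
    (I : TwoSidedIdeal (PathAlgebra K Q)) : Type (max u w s) :=
  I.ringCon.Quotient

/-- A `K`-algebra is triangular if it is isomorphic to a quotient `KQ/I`, where `Q` is a finite
quiver without oriented cycles and `I` is generated by linear combinations of parallel paths of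
lengths at least `2`. -/
def IsTriangular (K : Type u) [Field K] (A : Type u) [Ring A] [Algebra K A] : Prop :=
  ∃ (Q : Type u) (_ : Quiver.{u} Q) (_ : Fintype Q) (I : TwoSidedIdeal (PathAlgebra K Q)),
    (∀ a b : Q, Finite (a ⟶ b)) ∧ IsAcyclic Q ∧ IsRelationIdeal I ∧
      Nonempty (A ≃ₐ[K] QuotAlg I)

end Triangular

/-! ### The algebra `Λ⁻ = (1 - e) Λ (1 - e)` -/

section Corner

/-- The scalar multiplication of the corner ring `e A e` of a `K`-algebra `A`. -/
instance cornerModule (K : Type s) [Field K] {A : Type u} [Ring A] [Algebra K A] {e : A}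
    (he : IsIdempotentElem e) : Module K he.Corner where
  smul k x := ⟨k • x.1, by
    obtain ⟨a, ha⟩ := x.2
    exact ⟨k • a, by rw [← ha]; simp⟩⟩
  one_smul x := Subtype.ext (one_smul K x.1)
  mul_smul k l x := Subtype.ext (mul_smul k l x.1)
  smul_zero k := Subtype.ext (smul_zero (A := A) k)
  smul_add k x y := Subtype.ext (smul_add k x.1 y.1)
  add_smul k l x := Subtype.ext (add_smul k l x.1)
  zero_smul x := Subtype.ext (zero_smul K x.1)

/-- The corner ring `e A e` of a `K`-algebra `A` is a `K`-algebra (with unit `e`). -/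
instance cornerAlgebra (K : Type s) [Field K] {A : Type u} [Ring A] [Algebra K A] {e : A}
    (he : IsIdempotentElem e) : Algebra K he.Corner :=
  Algebra.ofModule
    (fun k x y => Subtype.ext (smul_mul_assoc k x.1 y.1))
    (fun k x y => Subtype.ext (mul_smul_comm k x.1 y.1))

variable {K : Type s} [Field K] {Q : Type u} [Quiver.{w} Q] [Fintype Q]

/-- The primitive idempotent `e_v` of `KQ/I` corresponding to the vertex `v`. -/
noncomputable def idem (I : TwoSidedIdeal (PathAlgebra K Q)) (v : Q) : QuotAlg I :=
  I.ringCon.mk' (PathAlgebra.vertexIdem v)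

theorem isIdempotentElem_idem (I : TwoSidedIdeal (PathAlgebra K Q)) (v : Q) :
    IsIdempotentElem (idem I v) := by
  unfold IsIdempotentElem idem
  rw [← map_mul, PathAlgebra.vertexIdem_mul_self]

/-- The algebra `Λ⁻ = (1 - e_v) Λ (1 - e_v)` for `Λ = KQ/I`. -/
abbrev Minus (I : TwoSidedIdeal (PathAlgebra K Q)) (v : Q) : Type (max u w s) :=
  (isIdempotentElem_idem I v).one_sub.Corner

end Corner

/-! ### Insertion of a poset at a vertex -/

section Insertion

/-- The Hasse quiver of a poset, with the elements of the poset as vertices. -/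
def Hasse (S : Type s) : Type s := S

/-- There is one arrow `s ⟶ t` in the Hasse quiver if `t` covers `s`, and no arrow otherwise. -/
instance (S : Type s) [PartialOrder S] : Quiver.{0} (Hasse S) where
  Hom a b := PLift (@CovBy S _ a b)

/-- A maximal path in the Hasse quiver: from a minimal to a maximal element. -/
structure MaximalPath (S : Type s) [PartialOrder S] where
  source : S
  target : S
  isMin : IsMin source
  isMax : IsMax target
  path : @Quiver.Path (Hasse S) _ source target

/-- The full subquiver of `Q` on all the vertices different from `v`. -/
def Deleted (Q : Type u) (v : Q) : Type u := {a : Q // a ≠ v}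

instance (Q : Type u) [Quiver.{w} Q] (v : Q) : Quiver.{w} (Deleted Q v) where
  Hom a b := a.1 ⟶ b.1

/-- The vertices of the quiver obtained by inserting `S` at `v`:
the vertices of `Q` different from `v`, and the elements of `S`. -/
def InsVertex (Q : Type u) (v : Q) (S : Type s) : Type (max u s) := Deleted Q v ⊕ S

noncomputable instance (Q : Type u) [Fintype Q] (v : Q) (S : Type s) [Fintype S] :
    Fintype (InsVertex Q v S) := by
  classical
  exact inferInstanceAs (Fintype ({a : Q // a ≠ v} ⊕ S))

/-- A vertex of `Q` different from `v`, as a vertex of the new quiver. -/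
def InsVertex.old {Q : Type u} {v : Q} {S : Type s} (a : Deleted Q v) : InsVertex Q v S :=
  Sum.inl a

/-- An element of `S`, as a vertex of the new quiver. -/
def InsVertex.new {Q : Type u} {v : Q} {S : Type s} (x : S) : InsVertex Q v S :=
  Sum.inr x

/-- The arrows of the quiver obtained by inserting `S` at `v`. -/
inductive InsArrow (Q : Type u) [Quiver.{w} Q] (v : Q) (S : Type s) [PartialOrder S] :
    InsVertex Q v S → InsVertex Q v S → Type (max u w s)
  /-- The arrows of `Q` which neither start nor end at `v`. -/
  | arrow {a b : Deleted Q v} (γ : a.1 ⟶ b.1) : InsArrow Q v S (.old a) (.old b)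
  /-- The arrows of the Hasse quiver of `S`. -/
  | cover {x y : S} (h : x ⋖ y) : InsArrow Q v S (.new x) (.new y)
  /-- The arrows `(α, x)`, where `α` ends at `v` and `x` is a minimal element of `S`. -/
  | enter {a : Deleted Q v} (α : a.1 ⟶ v) {x : S} (hx : IsMin x) :
      InsArrow Q v S (.old a) (.new x)
  /-- The arrows `(x, β)`, where `β` starts at `v` and `x` is a maximal element of `S`. -/
  | exit {x : S} (hx : IsMax x) {b : Deleted Q v} (β : v ⟶ b.1) :
      InsArrow Q v S (.new x) (.old b)

instance (Q : Type u) [Quiver.{w} Q] (v : Q) (S : Type s) [PartialOrder S] :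
    Quiver.{max u w s} (InsVertex Q v S) where
  Hom x y := InsArrow Q v S x y

variable {Q : Type u} [Quiver.{w} Q] {v : Q}

/-- A path in `Q` avoiding `v`, as a path in `Q`. -/
def pathInQ {a b : Deleted Q v} (p : Quiver.Path a b) : Quiver.Path a.1 b.1 :=
  Prefunctor.mapPath (V := Deleted Q v) (W := Q)
    { obj := fun c => c.1, map := fun γ => γ } p

/-- A path in `Q` avoiding `v`, as a path in the new quiver. -/
def pathOld (S : Type s) [PartialOrder S] {a b : Deleted Q v} (p : Quiver.Path a b) :
    Quiver.Path (InsVertex.old a : InsVertex Q v S) (.old b) :=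
  Prefunctor.mapPath (V := Deleted Q v) (W := InsVertex Q v S)
    { obj := fun c => .old c, map := fun γ => InsArrow.arrow γ } p

/-- A path in the Hasse quiver of `S`, as a path in the new quiver. -/
def pathNew (v : Q) {S : Type s} [PartialOrder S] {x y : S}
    (q : @Quiver.Path (Hasse S) _ x y) :
    Quiver.Path (InsVertex.new x : InsVertex Q v S) (.new y) :=
  Prefunctor.mapPath (V := Hasse S) (W := InsVertex Q v S)
    { obj := fun z => .new (S := S) z, map := fun h => InsArrow.cover h.down } q

/-- A path in `Q` from `a ≠ v` to `v`, written as a path avoiding `v` followed by the last arrow.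
(Since `Q` has no oriented cycles, every path from `a` to `v` is uniquely of this form.) -/
structure PathTo (a : Deleted Q v) where
  mid : Deleted Q v
  init : Quiver.Path a mid
  last : mid.1 ⟶ v

/-- The underlying path in `Q`. -/
def PathTo.path {a : Deleted Q v} (p : PathTo a) : Quiver.Path a.1 v :=
  (pathInQ p.init).cons p.last

/-- The path `(p, x)` obtained by replacing the last arrow `α` of `p` by `(α, x)`. -/
def PathTo.insert {S : Type s} [PartialOrder S] {x : S} (hx : IsMin x) {a : Deleted Q v}
    (p : PathTo a) : Quiver.Path (InsVertex.old a : InsVertex Q v S) (.new x) :=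
  (pathOld S p.init).cons (InsArrow.enter p.last hx)

/-- A path in `Q` from `v` to `b ≠ v`, written as its first arrow followed by a path avoiding `v`.
(Since `Q` has no oriented cycles, every path from `v` to `b` is uniquely of this form.) -/
structure PathFrom (b : Deleted Q v) where
  mid : Deleted Q v
  first : v ⟶ mid.1
  tail : Quiver.Path mid b

/-- The underlying path in `Q`. -/
def PathFrom.path {b : Deleted Q v} (p : PathFrom b) : Quiver.Path v b.1 :=
  (Quiver.Hom.toPath p.first).comp (pathInQ p.tail)

/-- The path `(x, p)` obtained by replacing the first arrow `β` of `p` by `(x, β)`. -/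
def PathFrom.insert {S : Type s} [PartialOrder S] {x : S} (hx : IsMax x) {b : Deleted Q v}
    (p : PathFrom b) : Quiver.Path (InsVertex.new x : InsVertex Q v S) (.old b) :=
  (Quiver.Path.nil.cons (InsArrow.exit hx p.first)).comp (pathOld S p.tail)

/-- A path in `Q` from `a ≠ v` to `b ≠ v`, which either avoids `v` or is the composition `p'p''`
of a path `p'` ending at `v` and a path `p''` starting at `v`.
(Since `Q` has no oriented cycles, every path from `a` to `b` is uniquely of this form.) -/
inductive PathBetween (a b : Deleted Q v) : Type (max u w)
  | avoid (p : Quiver.Path a b) : PathBetween a b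
  | through (p' : PathTo a) (p'' : PathFrom b) : PathBetween a b

/-- The underlying path in `Q`. -/
def PathBetween.path {a b : Deleted Q v} : PathBetween a b → Quiver.Path a.1 b.1
  | .avoid p => pathInQ p
  | .through p' p'' => p'.path.comp p''.path

/-- The path in the new quiver which equals the given path if it avoids `v`, and which is
`(p', h(q)) q (t(q), p'')` if the given path is `p'p''` passing through `v`,
for a maximal path `q` in the Hasse quiver from `h(q)` to `t(q)`. -/
def PathBetween.insert {S : Type s} [PartialOrder S] (q : MaximalPath S) {a b : Deleted Q v} :
    PathBetween a b → Quiver.Path (InsVertex.old a : InsVertex Q v S) (.old b)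
  | .avoid p => pathOld S p
  | .through p' p'' =>
      ((p'.insert q.isMin).comp (pathNew v q.path)).comp (p''.insert q.isMax)

variable [Fintype Q]

open PathAlgebra in
/-- The relations defining the insertion of `S` at `v` into `KQ/I`. -/
inductive InsRelation {K : Type*} [Field K] (I : TwoSidedIdeal (PathAlgebra K Q)) (v : Q)
    (S : Type s) [PartialOrder S] : PathAlgebra K (InsVertex Q v S) → Prop
  /-- `∑ c_p (p, x)` for `x` minimal and `∑ c_p p ∈ I` a combination of parallel paths
  ending at `v`. -/
  | ending {a : Deleted Q v} {x : S} (hx : IsMin x) (c : PathTo a →₀ K)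
      (hc : of (c.mapDomain PathTo.path) ∈ I) :
      InsRelation I v S (of (c.mapDomain (PathTo.insert hx)))
  /-- `∑ c_p (x, p)` for `x` maximal and `∑ c_p p ∈ I` a combination of parallel paths
  starting at `v`. -/
  | starting {b : Deleted Q v} {x : S} (hx : IsMax x) (c : PathFrom b →₀ K)
      (hc : of (c.mapDomain PathFrom.path) ∈ I) :
      InsRelation I v S (of (c.mapDomain (PathFrom.insert hx)))
  /-- `q' - q''` for parallel paths `q', q''` in the Hasse quiver. -/
  | comm {x y : S} (q' q'' : @Quiver.Path (Hasse S) _ x y) :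
      InsRelation I v S (ofPath (pathNew v q') - ofPath (pathNew v q''))
  /-- `(α, h(q')) q' - (α, h(q'')) q''` for an arrow `α` ending at `v` and paths `q', q''` in the
  Hasse quiver which start at minimal elements and end at the same element. -/
  | commEnter {a : Deleted Q v} (α : a.1 ⟶ v) {x' x'' y : S} (hx' : IsMin x') (hx'' : IsMin x'')
      (q' : @Quiver.Path (Hasse S) _ x' y) (q'' : @Quiver.Path (Hasse S) _ x'' y) :
      InsRelation I v S
        (ofPath ((Quiver.Path.nil.cons (InsArrow.enter α hx')).comp (pathNew v q')) -
          ofPath ((Quiver.Path.nil.cons (InsArrow.enter α hx'')).comp (pathNew v q'')))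
  /-- `q' (t(q'), β) - q'' (t(q''), β)` for an arrow `β` starting at `v` and paths `q', q''` in the
  Hasse quiver which start at the same element and end at maximal elements. -/
  | commExit {b : Deleted Q v} (β : v ⟶ b.1) {x y' y'' : S} (hy' : IsMax y') (hy'' : IsMax y'')
      (q' : @Quiver.Path (Hasse S) _ x y') (q'' : @Quiver.Path (Hasse S) _ x y'') :
      InsRelation I v S
        (ofPath ((pathNew v q').cons (InsArrow.exit hy' β)) -
          ofPath ((pathNew v q'').cons (InsArrow.exit hy'' β)))
  /-- `(α, h(q')) q' (t(q'), β) - (α, h(q'')) q'' (t(q''), β)` for an arrow `α` ending at `v`,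
  an arrow `β` starting at `v`, and maximal paths `q', q''` in the Hasse quiver. -/
  | commThrough {a b : Deleted Q v} (α : a.1 ⟶ v) (β : v ⟶ b.1) (q' q'' : MaximalPath S) :
      InsRelation I v S
        (ofPath (((Quiver.Path.nil.cons (InsArrow.enter α q'.isMin)).comp
            (pathNew v q'.path)).cons (InsArrow.exit q'.isMax β)) -
          ofPath (((Quiver.Path.nil.cons (InsArrow.enter α q''.isMin)).comp
            (pathNew v q''.path)).cons (InsArrow.exit q''.isMax β)))
  /-- `∑ c_p p̃` for `∑ c_p p ∈ I` a combination of parallel paths which neither start nor end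
  at `v`, where `p̃` is formed using a maximal path `q` in the Hasse quiver. -/
  | passing {a b : Deleted Q v} (q : MaximalPath S) (c : PathBetween a b →₀ K)
      (hc : of (c.mapDomain PathBetween.path) ∈ I) :
      InsRelation I v S (of (c.mapDomain (PathBetween.insert q)))

/-- The insertion of the finite poset `S` at the vertex `v` into the algebra `KQ/I`. -/
abbrev Insertion {K : Type*} [Field K] (I : TwoSidedIdeal (PathAlgebra K Q)) (v : Q)
    (S : Type s) [PartialOrder S] [Fintype S] :=
  QuotAlg (TwoSidedIdeal.span {x : PathAlgebra K (InsVertex Q v S) | InsRelation I v S x})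

end Insertion

/-! ### The tower -/

/-- The sequence `Λ⁻, Λ, Λ ← A₂, Λ ← A₃, …` for `Λ = KQ/I`, where `Λ ← A_i` is the insertion at
the vertex `v` of the chain with `i` elements. -/
noncomputable def tower {K : Type u} [Field K] {Q : Type u} [Quiver.{u} Q] [Fintype Q]
    (I : TwoSidedIdeal (PathAlgebra K Q)) (v : Q) : ℕ → AlgCat.{u} K
  | 0 => AlgCat.of K (Minus I v)
  | 1 => AlgCat.of K (QuotAlg I)
  | i + 2 => AlgCat.of K (Insertion I v (Fin (i + 2)))

end TriangularAlgebra

/-! Every algebra of the tower is directed: it has a complete family of orthogonal idempotents `e a`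
with `e a A e a = K`, and a nonzero component `e a A e b` with `a ≠ b` can only occur when a rank
function increases from `a` to `b`. For such an algebra the modules `e a A` are, up to isomorphism
and without repetition, the indecomposable projectives (`IsDirected.equivClass`), so the Cartan
matrix is the transpose of the matrix of dimensions of the `e a A e b`. Ordered by rank this matrix
is unitriangular (`IsDirected.det_dimMatrix`). Its determinant `1` is the top coefficient of `det (x
C + Cᵀ)`, so the degree of the Coxeter polynomial is the number of idempotents, which grows by one
at each stage of the tower.

An inserted chain is studied by collapsing it back to `v`. Except from a later to an earlier element
of the chain, collapsing is a bijection from the paths between two vertices onto the paths of `Q`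
between their images (`projPath_injective`, `exists_projPath_eq`), and it matches the ideal of the
insertion with `I` (`of_mem_insIdeal_iff`). For a chain with one element this gives the isomorphism
with `Λ`. In general each element of the chain sees the other vertices as `v` did, and the elements
of the chain see each other through their order; passing to `Λ⁻` merely deletes `v`. Thus all
dimension matrices in the tower have the same shape `towerMatrix`, with a chain block of growing
size.

The recurrence is then linear algebra: in `x C + Cᵀ` the rows and columns of the last two elements
of the chain agree outside their common 2 by 2 block. Subtracting one from the other leaves a
determinant which expands into the three terms (`det_fromBlocks_repeat`).

For `i ≥ 1` the defining presentation shows that the algebra is triangular. For `Λ⁻` no presentation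
is given, and one is constructed for any finite-dimensional directed algebra from its Gabriel
quiver, whose arrows are bases of complements of the square of the radical in the radical
(`IsDirected.isTriangular`). -/

namespace TriangularAlgebra

namespace PathAlgebra

/-! ### Components of the path algebra -/

section Components

variable {K : Type*} [Field K] {Q : Type*} [Quiver Q]

theorem of_apply_self {a b : Q} (x : Quiver.Path a b →₀ K) : (of x) a b = x := by
  simp [of]

theorem of_apply_ne_left {a b c d : Q} (x : Quiver.Path a b →₀ K) (h : c ≠ a) :
    (of x) c d = 0 := by
  have : of x c = 0 := by
    classical
    unfold of
    exact Pi.single_eq_of_ne h _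
  exact congr_fun this d

theorem of_apply_ne_right {a b c d : Q} (x : Quiver.Path a b →₀ K) (h : d ≠ b) :
    (of x) c d = 0 := by
  by_cases hc : c = a
  · classical
    subst hc
    unfold of
    rw [Pi.single_eq_same, Pi.single_eq_of_ne h]
  · exact of_apply_ne_left x hc

theorem of_add {a b : Q} (x y : Quiver.Path a b →₀ K) : of (x + y) = of x + of y := by
  classical
  unfold of
  rw [Pi.single_add]
  exact Pi.single_add a _ _

theorem of_smul {a b : Q} (k : K) (x : Quiver.Path a b →₀ K) : of (k • x) = k • of x := by
  classical
  unfold of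
  rw [Pi.single_smul]
  exact Pi.single_smul a _ _

variable (K) in
/-- The inclusion of a component of the path algebra, as a linear map. -/
noncomputable def ofₗ (a b : Q) : (Quiver.Path a b →₀ K) →ₗ[K] PathAlgebra K Q where
  toFun := of
  map_add' := of_add
  map_smul' := of_smul

theorem ofₗ_apply {a b : Q} (x : Quiver.Path a b →₀ K) : ofₗ K a b x = of x := rfl

theorem of_zero (a b : Q) : of (0 : Quiver.Path a b →₀ K) = 0 := map_zero (ofₗ K a b)

theorem of_injective (a b : Q) :
    Function.Injective (of : (Quiver.Path a b →₀ K) → PathAlgebra K Q) := fun x y h => by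
  rw [← of_apply_self x, h, of_apply_self]

theorem of_single {a b : Q} (p : Quiver.Path a b) (k : K) :
    of (Finsupp.single p k) = k • ofPath p := by
  rw [ofPath, ← of_smul, Finsupp.smul_single, smul_eq_mul, mul_one]

theorem sum_apply {ι : Type*} (t : Finset ι) (f : ι → PathAlgebra K Q) (a b : Q) :
    (∑ i ∈ t, f i) a b = ∑ i ∈ t, f i a b := by
  classical
  induction t using Finset.induction_on with
  | empty => rfl
  | insert i t hi ih => rw [Finset.sum_insert hi, Finset.sum_insert hi, add_apply, ih]

theorem concat_single {a b c : Q} (p : Quiver.Path a b) (q : Quiver.Path b c) (k l : K) :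
    concat (Finsupp.single p k) (Finsupp.single q l) = Finsupp.single (p.comp q) (k * l) := by
  simp [concat]

variable [Fintype Q]

theorem eq_sum_of (z : PathAlgebra K Q) : z = ∑ a : Q, ∑ b : Q, of (z a b) := by
  classical
  funext a b
  rw [sum_apply, Finset.sum_eq_single a, sum_apply, Finset.sum_eq_single b, of_apply_self]
  · exact fun c _ hc => of_apply_ne_right _ hc.symm
  · simp
  · intro c _ hc
    rw [sum_apply]
    exact Finset.sum_eq_zero fun d _ => of_apply_ne_left _ hc.symm
  · simp

theorem of_mul_of {a b c : Q} (x : Quiver.Path a b →₀ K) (y : Quiver.Path b c →₀ K) :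
    of x * of y = of (concat x y) := by
  classical
  funext a' c'
  rw [mul_apply, Finset.sum_eq_single b]
  · by_cases ha : a' = a
    · subst ha
      by_cases hc : c' = c
      · subst hc
        simp only [of_apply_self]
      · rw [of_apply_ne_right _ hc, of_apply_ne_right _ hc, concat_zero]
    · rw [of_apply_ne_left _ ha, of_apply_ne_left _ ha, zero_concat]
  · intro b' _ hb
    rw [of_apply_ne_right _ hb, zero_concat]
  · simp

theorem of_mul_of_ne {a b b' c : Q} (h : b ≠ b') (x : Quiver.Path a b →₀ K)
    (y : Quiver.Path b' c →₀ K) : of x * of y = 0 := by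
  classical
  funext a' c'
  rw [mul_apply]
  refine Finset.sum_eq_zero fun d _ => ?_
  by_cases hd : d = b
  · subst hd
    rw [of_apply_ne_left _ h, concat_zero]
  · rw [of_apply_ne_right _ hd, zero_concat]

theorem ofPath_mul_ofPath {a b c : Q} (p : Quiver.Path a b) (q : Quiver.Path b c) :
    (ofPath p * ofPath q : PathAlgebra K Q) = ofPath (p.comp q) := by
  rw [ofPath, ofPath, of_mul_of, concat_single, one_mul, ofPath]

theorem ofPath_mul_ofPath_ne {a b b' c : Q} (h : b ≠ b') (p : Quiver.Path a b)
    (q : Quiver.Path b' c) : (ofPath p * ofPath q : PathAlgebra K Q) = 0 :=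
  of_mul_of_ne h _ _

theorem one_eq_sum : (1 : PathAlgebra K Q) = ∑ v : Q, vertexIdem v := rfl

theorem vertexIdem_mul_of {a b : Q} (x : Quiver.Path a b →₀ K) :
    vertexIdem a * of x = of x := by
  rw [vertexIdem, ofPath, of_mul_of, nil_concat]

theorem of_mul_vertexIdem {a b : Q} (x : Quiver.Path a b →₀ K) :
    of x * vertexIdem b = of x := by
  rw [vertexIdem, ofPath, of_mul_of, concat_nil]

theorem vertexIdem_mul_of_ne {a b c : Q} (h : c ≠ a) (x : Quiver.Path a b →₀ K) :
    vertexIdem c * of x = 0 :=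
  of_mul_of_ne h _ _

theorem of_mul_vertexIdem_ne {a b c : Q} (h : b ≠ c) (x : Quiver.Path a b →₀ K) :
    of x * vertexIdem c = 0 :=
  of_mul_of_ne h _ _

theorem vertexIdem_mul_mul_vertexIdem (z : PathAlgebra K Q) (a b : Q) :
    vertexIdem a * z * vertexIdem b = of (z a b) := by
  classical
  conv_lhs => rw [eq_sum_of z]
  rw [Finset.mul_sum, Finset.sum_mul, Finset.sum_eq_single a, Finset.mul_sum, Finset.sum_mul,
    Finset.sum_eq_single b]
  · rw [vertexIdem_mul_of, of_mul_vertexIdem]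
  · intro c _ hc
    rw [vertexIdem_mul_of, of_mul_vertexIdem_ne hc]
  · simp
  · intro c _ hc
    rw [Finset.mul_sum, Finset.sum_mul]
    refine Finset.sum_eq_zero fun d _ => ?_
    rw [vertexIdem_mul_of_ne hc.symm, zero_mul]
  · simp

/-- Multiplying by trivial paths on both sides isolates a component. Hence a two-sided ideal is
determined by the combinations of parallel paths in it, and ideals can be compared one component at
a time. -/
theorem mem_iff_of_mem (I : TwoSidedIdeal (PathAlgebra K Q)) (z : PathAlgebra K Q) :
    z ∈ I ↔ ∀ a b, of (z a b) ∈ I := by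
  refine ⟨fun h a b => ?_, fun h => ?_⟩
  · rw [← vertexIdem_mul_mul_vertexIdem]
    exact I.mul_mem_right _ _ (I.mul_mem_left _ _ h)
  · rw [eq_sum_of z]
    exact I.finsetSum_mem _ _ fun a _ => I.finsetSum_mem _ _ fun b _ => h a b

theorem smul_mem (I : TwoSidedIdeal (PathAlgebra K Q)) (k : K) {z : PathAlgebra K Q}
    (hz : z ∈ I) : k • z ∈ I := by
  have := I.mul_mem_left (algebraMap K _ k) z hz
  rwa [← Algebra.smul_def] at this

end Components

/-! ### Homomorphisms out of the path algebra -/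

section Lift

variable {K : Type*} [Field K] {Q : Type*} [Quiver Q] [Fintype Q]
  {A : Type*} [Ring A] [Algebra K A]

/-- The linear extension to the path algebra of a map defined on paths. -/
noncomputable def linearLift (f : ∀ a b : Q, Quiver.Path a b → A) : PathAlgebra K Q →ₗ[K] A where
  toFun z := ∑ a : Q, ∑ b : Q, Finsupp.linearCombination K (f a b) (z a b)
  map_add' x y := by simp only [add_apply, map_add, Finset.sum_add_distrib]
  map_smul' k x := by simp only [smul_apply, map_smul, Finset.smul_sum, RingHom.id_apply]

theorem linearLift_of (f : ∀ a b : Q, Quiver.Path a b → A) {a b : Q}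
    (x : Quiver.Path a b →₀ K) : linearLift f (of x) = Finsupp.linearCombination K (f a b) x := by
  classical
  change ∑ a' : Q, ∑ b' : Q, Finsupp.linearCombination K (f a' b') (of x a' b') = _
  rw [Finset.sum_eq_single a, Finset.sum_eq_single b, of_apply_self]
  · intro c _ hc
    rw [of_apply_ne_right _ hc, map_zero]
  · simp
  · intro c _ hc
    refine Finset.sum_eq_zero fun d _ => ?_
    rw [of_apply_ne_left _ hc, map_zero]
  · simp

theorem linearLift_ofPath (f : ∀ a b : Q, Quiver.Path a b → A) {a b : Q}
    (p : Quiver.Path a b) : linearLift f (ofPath p : PathAlgebra K Q) = f a b p := by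
  rw [ofPath, linearLift_of, Finsupp.linearCombination_single, one_smul]

/-- Two linear maps on the path algebra which agree on paths are equal. -/
theorem linearMap_ext {M : Type*} [AddCommGroup M] [Module K M]
    {f g : PathAlgebra K Q →ₗ[K] M} (h : ∀ (a b : Q) (p : Quiver.Path a b),
      f (ofPath p) = g (ofPath p)) : f = g := by
  have key : ∀ a b : Q, f ∘ₗ ofₗ K a b = g ∘ₗ ofₗ K a b := fun a b =>
    Finsupp.lhom_ext' fun p => LinearMap.ext_ring (h a b p)
  refine LinearMap.ext fun z => ?_
  rw [eq_sum_of z]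
  simp only [map_sum]
  exact Finset.sum_congr rfl fun a _ => Finset.sum_congr rfl fun b _ =>
    LinearMap.congr_fun (key a b) (z a b)

/-- The algebra homomorphism defined by a multiplicative map on paths. -/
noncomputable def lift (f : ∀ a b : Q, Quiver.Path a b → A)
    (h1 : ∑ a : Q, f a a Quiver.Path.nil = 1)
    (hmul : ∀ (a b c : Q) (p : Quiver.Path a b) (q : Quiver.Path b c),
      f a c (p.comp q) = f a b p * f b c q)
    (hne : ∀ (a b b' c : Q) (p : Quiver.Path a b) (q : Quiver.Path b' c), b ≠ b' →
      f a b p * f b' c q = 0) : PathAlgebra K Q →ₐ[K] A :=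
  AlgHom.ofLinearMap (linearLift f)
    (by
      rw [one_eq_sum, map_sum, ← h1]
      exact Finset.sum_congr rfl fun a _ => linearLift_ofPath f _)
    (by
      -- Multiplicativity is an equality of two bilinear maps, so it suffices to check it on pairs
      -- of paths.
      have key : (LinearMap.mul K A).compl₁₂ (linearLift f) (linearLift f) =
          (LinearMap.mul K (PathAlgebra K Q)).compr₂ (linearLift f) := by
        refine linearMap_ext fun a b p => linearMap_ext fun b' c q => ?_
        simp only [LinearMap.compl₁₂_apply, LinearMap.compr₂_apply, LinearMap.mul_apply',
          linearLift_ofPath]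
        by_cases hb : b = b'
        · subst hb
          rw [ofPath_mul_ofPath, linearLift_ofPath, hmul]
        · rw [ofPath_mul_ofPath_ne hb, map_zero, hne _ _ _ _ _ _ hb]
      intro x y
      exact (LinearMap.congr_fun (LinearMap.congr_fun key x) y).symm)

end Lift

end PathAlgebra

/-! ### Quotients of the path algebra -/

section Quotient

variable {K : Type*} [Field K] {Q : Type*} [Quiver Q] [Fintype Q]
  (I : TwoSidedIdeal (PathAlgebra K Q))

/-- The projection of the path algebra onto its quotient. -/
noncomputable def quotMk : PathAlgebra K Q →ₐ[K] QuotAlg I :=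
  I.ringCon.mkₐ K

theorem quotMk_surjective : Function.Surjective (quotMk I) :=
  I.ringCon.mkₐ_surjective

theorem quotMk_eq_zero_iff (z : PathAlgebra K Q) : quotMk I z = 0 ↔ z ∈ I := by
  rw [← map_zero (quotMk I), I.mem_iff]
  exact Quotient.eq''

theorem quotMk_vertexIdem (v : Q) : quotMk I (PathAlgebra.vertexIdem v) = idem I v := rfl

/-- A surjective algebra homomorphism induces an isomorphism on the quotient by its kernel. -/
theorem nonempty_quotAlg_equiv {A : Type*} [Ring A] [Algebra K A] (f : PathAlgebra K Q →ₐ[K] A)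
    (hf : Function.Surjective f) (hI : ∀ z, f z = 0 ↔ z ∈ I) : Nonempty (QuotAlg I ≃ₐ[K] A) := by
  have hrel : ∀ x y, I.ringCon x y ↔ f x = f y := fun x y => by
    rw [I.rel_iff, ← hI, map_sub, sub_eq_zero]
  let g : QuotAlg I →ₐ[K] A := I.ringCon.liftₐ f fun x y h => (hrel x y).1 h
  have hg : ∀ x, g (quotMk I x) = f x := fun x => rfl
  refine ⟨AlgEquiv.ofBijective g ⟨fun x y h => ?_, fun a => ?_⟩⟩
  · obtain ⟨x, rfl⟩ := quotMk_surjective I x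
    obtain ⟨y, rfl⟩ := quotMk_surjective I y
    rw [hg, hg, ← sub_eq_zero, ← map_sub, hI, ← quotMk_eq_zero_iff, map_sub, sub_eq_zero] at h
    exact h
  · obtain ⟨x, rfl⟩ := hf a
    exact ⟨quotMk I x, hg x⟩

end Quotient

/-! ### Peirce components -/

section Peirce

variable (K : Type*) [Field K] {A : Type*} [Ring A] [Algebra K A]

/-- The component `e A f` of an algebra, for elements `e` and `f`. -/
def peirce (e f : A) : Submodule K A :=
  LinearMap.range (LinearMap.mulLeftRight K (e, f))

variable {K}

theorem mem_peirce {e f x : A} : x ∈ peirce K e f ↔ ∃ y, e * y * f = x := by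
  simp [peirce, LinearMap.mem_range]

theorem mul_mul_mem_peirce (e f y : A) : e * y * f ∈ peirce K e f :=
  mem_peirce.2 ⟨y, rfl⟩

theorem mul_eq_of_mem_peirce {e f x : A} (he : IsIdempotentElem e) (hx : x ∈ peirce K e f) :
    e * x = x := by
  obtain ⟨y, rfl⟩ := mem_peirce.1 hx
  rw [← mul_assoc, ← mul_assoc, he.eq]

theorem mul_eq_of_mem_peirce' {e f x : A} (hf : IsIdempotentElem f) (hx : x ∈ peirce K e f) :
    x * f = x := by
  obtain ⟨y, rfl⟩ := mem_peirce.1 hx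
  rw [mul_assoc, hf.eq]

theorem mul_mem_peirce {e f g x y : A} (he : IsIdempotentElem e) (hg : IsIdempotentElem g)
    (hx : x ∈ peirce K e f) (hy : y ∈ peirce K f g) : x * y ∈ peirce K e g :=
  mem_peirce.2 ⟨x * y, by
    rw [← mul_assoc, mul_eq_of_mem_peirce he hx, mul_assoc, mul_eq_of_mem_peirce' hg hy]⟩

end Peirce

/-! ### Directed algebras -/

section Directed

variable (K : Type*) [Field K] {A : Type*} [Ring A] [Algebra K A] {n : Type*} [Fintype n]

/-- A complete family of orthogonal idempotents `e a` with `e a A e a = K`, such that the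
components `e a A e b` with `a ≠ b` vanish unless the rank of `b` exceeds the rank of `a`. -/
structure IsDirected (e : n → A) (r : n → ℤ) : Prop extends CompleteOrthogonalIdempotents e where
  ne_zero (a : n) : e a ≠ 0
  scalar (a : n) (x : A) : ∃ k : K, e a * x * e a = k • e a
  rank_lt (a b : n) (x : A) : a ≠ b → e a * x * e b ≠ 0 → r a < r b

variable {K} {e : n → A} {r : n → ℤ}

/-- Right modules are left modules over the opposite ring, so the module theory below is applied to
`Aᵐᵒᵖ`. Passing to it exchanges `e a A e b` with `e b A e a`, whence the sign of the rank. -/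
theorem IsDirected.op (h : IsDirected K e r) :
    IsDirected K (fun a => MulOpposite.op (e a)) (fun a => -r a) where
  idem a := by
    unfold IsIdempotentElem
    rw [← MulOpposite.op_mul, (h.idem a).eq]
  ortho a b hab := by
    change MulOpposite.op (e a) * MulOpposite.op (e b) = 0
    rw [← MulOpposite.op_mul, h.ortho hab.symm, MulOpposite.op_zero]
  complete := by
    rw [← MulOpposite.op_one, ← h.complete]
    exact (map_sum (MulOpposite.opAddEquiv : A ≃+ Aᵐᵒᵖ) e Finset.univ).symm
  ne_zero a := by simpa using h.ne_zero a
  scalar a x := by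
    obtain ⟨k, hk⟩ := h.scalar a x.unop
    refine ⟨k, MulOpposite.unop_injective ?_⟩
    simpa [mul_assoc] using hk
  rank_lt a b x hab hx := by
    refine neg_lt_neg (h.rank_lt b a x.unop hab.symm fun h0 => hx ?_)
    exact MulOpposite.unop_injective (by simpa [mul_assoc] using h0)

end Directed

/-! ### Indecomposable projective modules of a directed algebra -/

section Modules

variable {K : Type w} [Field K] {A : Type u} [Ring A] [Algebra K A] {n : Type*} [Fintype n]
  {e : n → A} {r : n → ℤ}

/-- The left ideal `A e`. -/
def leftIdeal (e : A) : Submodule A A :=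
  LinearMap.range (LinearMap.toSpanSingleton A A e)

theorem mem_leftIdeal {e : A} (he : IsIdempotentElem e) {x : A} :
    x ∈ leftIdeal e ↔ x * e = x := by
  refine ⟨?_, fun h => ⟨x, h⟩⟩
  rintro ⟨y, rfl⟩
  simp [mul_assoc, he.eq]

theorem self_mem_leftIdeal (e : A) : e ∈ leftIdeal e := ⟨1, by simp⟩

instance (e : A) : Module.Finite A (leftIdeal e) :=
  inferInstanceAs (Module.Finite A (LinearMap.range _))

theorem projective_leftIdeal {e : A} (he : IsIdempotentElem e) :
    Module.Projective A (leftIdeal e) := by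
  refine Module.Projective.of_split (leftIdeal e).subtype
    (LinearMap.toSpanSingleton A A e).rangeRestrict (LinearMap.ext fun x => Subtype.ext ?_)
  exact (mem_leftIdeal he).1 x.2

/-- The module `A e` for an idempotent `e`, as an object of the category of modules. -/
def projModule (e : A) : ModuleCat.{u} A := ModuleCat.of A (leftIdeal e)

/-- The morphisms `A e ⟶ A f` are given by the elements of `e A f`. -/
noncomputable def projModuleHomEquiv {e f : A} (he : IsIdempotentElem e)
    (hf : IsIdempotentElem f) : (projModule e ⟶ projModule f) ≃ₗ[K] peirce K e f where
  toFun φ := ⟨(φ.hom ⟨e, self_mem_leftIdeal e⟩).1, mem_peirce.2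
    ⟨(φ.hom ⟨e, self_mem_leftIdeal e⟩).1, by
      -- Linearity and `e * e = e` show that the image of the generator `e` is fixed by left
      -- multiplication by `e`.
      have h1 : e * (φ.hom ⟨e, self_mem_leftIdeal e⟩).1 =
          (φ.hom ⟨e, self_mem_leftIdeal e⟩).1 := by
        have := φ.hom.map_smul e ⟨e, self_mem_leftIdeal e⟩
        have h2 : (e • (⟨e, self_mem_leftIdeal e⟩ : leftIdeal e)) = ⟨e, self_mem_leftIdeal e⟩ :=
          Subtype.ext he.eq
        erw [h2] at this
        exact (congrArg Subtype.val this).symm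
      rw [h1]
      exact (mem_leftIdeal hf).1 (φ.hom ⟨e, self_mem_leftIdeal e⟩).2⟩⟩
  map_add' φ ψ := rfl
  map_smul' k φ := Subtype.ext (by
    change algebraMap K A k * _ = k • _
    rw [Algebra.smul_def])
  invFun y := ModuleCat.ofHom (LinearMap.codRestrict (leftIdeal f)
    ((LinearMap.toSpanSingleton A A y.1).comp (leftIdeal e).subtype)
    fun x => (mem_leftIdeal hf).2 (by
      simp [mul_assoc, mul_eq_of_mem_peirce' hf y.2]))
  left_inv φ := by
    ext x
    change x.1 * (φ.hom ⟨e, self_mem_leftIdeal e⟩).1 = (φ.hom x).1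
    have := φ.hom.map_smul x.1 ⟨e, self_mem_leftIdeal e⟩
    have h2 : (x.1 • (⟨e, self_mem_leftIdeal e⟩ : leftIdeal e)) = x :=
      Subtype.ext ((mem_leftIdeal he).1 x.2)
    erw [h2] at this
    exact (congrArg Subtype.val this).symm
  right_inv y := Subtype.ext (mul_eq_of_mem_peirce he y.2)

theorem exists_smul_id_of_end {a : A} (ha : IsIdempotentElem a)
    (hs : ∀ x, ∃ k : K, a * x * a = k • a) (φ : projModule a ⟶ projModule a) :
    ∃ k : K, φ = k • 𝟙 (projModule a) := by
  obtain ⟨y, hy⟩ := mem_peirce.1 (projModuleHomEquiv (K := K) ha ha φ).2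
  obtain ⟨k, hk⟩ := hs y
  refine ⟨k, (projModuleHomEquiv (K := K) ha ha).injective (Subtype.ext ?_)⟩
  rw [← hy, hk, map_smul]
  rfl

/-- An object all of whose endomorphisms are scalars is indecomposable. -/
theorem indecomposable_of_end {C : Type*} [Category* C] [Preadditive C]
    [Limits.HasBinaryBiproducts C] [Linear K C] {X : C} (hX : ¬ Limits.IsZero X)
    (h : ∀ φ : X ⟶ X, ∃ k : K, φ = k • 𝟙 X) : Indecomposable X := by
  refine ⟨hX, fun Y Z f => ?_⟩
  -- The idempotent projecting onto `Y` is a scalar `k`. Conjugated back, `k = 0` makes the identity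
  -- of `Y` vanish, while `k ≠ 0` makes that of `Z` vanish because the projection is zero on `Z`.
  obtain ⟨k, hk⟩ := h (f.hom ≫ Limits.biprod.fst ≫ Limits.biprod.inl ≫ f.inv)
  by_cases hk0 : k = 0
  · left
    rw [Limits.IsZero.iff_id_eq_zero]
    have := congrArg (fun φ => Limits.biprod.inl ≫ f.inv ≫ φ ≫ f.hom ≫ Limits.biprod.fst) hk
    simpa [hk0] using this
  · right
    rw [Limits.IsZero.iff_id_eq_zero]
    have := congrArg (fun φ => Limits.biprod.inr ≫ f.inv ≫ φ ≫ f.hom ≫ Limits.biprod.snd) hk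
    have h0 : k • 𝟙 Z = 0 := by simpa using this.symm
    rw [← one_smul K (𝟙 Z), ← inv_mul_cancel₀ hk0, mul_smul, h0, smul_zero]

theorem IsDirected.indecomposable (h : IsDirected K e r) (a : n) :
    Indecomposable (projModule (e a)) := by
  refine indecomposable_of_end (K := K) (fun h0 => h.ne_zero a ?_)
    (exists_smul_id_of_end (h.idem a) (h.scalar a))
  have : Subsingleton (leftIdeal (e a)) := ModuleCat.subsingleton_of_isZero h0
  exact congrArg Subtype.val (Subsingleton.elim
    (⟨e a, self_mem_leftIdeal _⟩ : leftIdeal (e a)) 0)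

/-- For `a ≠ b`, an isomorphism and its inverse would give nonzero elements of `e a A e b` and of `e
b A e a`, so the rank would have to increase in both directions. -/
theorem IsDirected.eq_of_iso (h : IsDirected K e r) {a b : n}
    (f : projModule (e a) ≅ projModule (e b)) : a = b := by
  by_contra hab
  have key : ∀ {a b : n} (f : projModule (e a) ≅ projModule (e b)), a ≠ b → r a < r b := by
    intro a b f hab
    obtain ⟨y, hy⟩ := mem_peirce.1 (projModuleHomEquiv (K := K) (h.idem a) (h.idem b) f.hom).2
    refine h.rank_lt a b y hab fun h0 => (h.indecomposable a).1 ?_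
    have hf : f.hom = 0 := by
      refine (projModuleHomEquiv (K := K) (h.idem a) (h.idem b)).injective (Subtype.ext ?_)
      rw [← hy, h0, map_zero]
      rfl
    rw [Limits.IsZero.iff_id_eq_zero, ← f.hom_inv_id, hf, Limits.zero_comp]
  exact lt_asymm (key f hab) (key f.symm (Ne.symm hab))

/-- An indecomposable module which has `A a` as a retract is isomorphic to `A a`. -/
theorem nonempty_iso_of_retraction {a : A} (ha : a ≠ 0) {P : ModuleCat.{u} A}
    (hP : Indecomposable P) (g : P →ₗ[A] leftIdeal a) (s : leftIdeal a →ₗ[A] P)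
    (hgs : ∀ z, g (s z) = z) : Nonempty (P ≅ projModule a) := by
  -- The retraction splits `P` as `A a` plus the kernel of `g`. The first summand is nonzero, so
  -- indecomposability kills the kernel.
  let E : P ≃ₗ[A] (leftIdeal a × LinearMap.ker g) :=
    { toFun := fun p => (g p, ⟨p - s (g p), by simp [hgs]⟩)
      map_add' := fun p q => by
        refine Prod.ext (map_add g p q) (Subtype.ext ?_)
        simp only [map_add, Prod.snd_add, Submodule.coe_add]
        abel
      map_smul' := fun c p => by
        refine Prod.ext (map_smul g c p) (Subtype.ext ?_)
        simp [smul_sub]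
      invFun := fun q => s q.1 + q.2.1
      left_inv := fun p => by simp
      right_inv := fun q => by
        have : g q.2.1 = 0 := q.2.2
        refine Prod.ext (by simp [hgs, this]) (Subtype.ext (by simp [hgs, this])) }
  have hiso : P ≅ projModule a ⊞ ModuleCat.of A (LinearMap.ker g) :=
    E.toModuleIso ≪≫ (ModuleCat.biprodIsoProd (projModule a) (ModuleCat.of A _)).symm
  rcases hP.2 _ _ hiso with h0 | h0
  · exfalso
    have : Subsingleton (leftIdeal a) := ModuleCat.subsingleton_of_isZero h0
    exact ha (congrArg Subtype.val (Subsingleton.elim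
      (⟨a, self_mem_leftIdeal _⟩ : leftIdeal a) 0))
  · have : Subsingleton (LinearMap.ker g) := ModuleCat.subsingleton_of_isZero h0
    have hinj : Function.Injective g := by
      rw [← LinearMap.ker_eq_bot]
      exact (Submodule.subsingleton_iff_eq_bot).1 this
    exact ⟨(LinearEquiv.ofBijective g ⟨hinj, fun z => ⟨s z, hgs z⟩⟩).toModuleIso⟩

/-- Choose `a` of maximal rank with `e a P ≠ 0` and a nonzero `x` in `e a P`, and expand `x` by a
section of the canonical surjection onto `P` from a free module. The part of a coefficient in `e a A
e b` with `b ≠ a` contributes nothing: either it is zero, or `b` has larger rank and `e b P = 0`. So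
some coefficient has a nonzero part in `e a A e a = K`, and the corresponding coordinate function
exhibits `A e a` as a retract of `P`. -/
theorem IsDirected.exists_iso_projModule (h : IsDirected K e r) {P : ModuleCat.{u} A}
    (hproj : Module.Projective A P) (hP : Indecomposable P) :
    ∃ a : n, Nonempty (P ≅ projModule (e a)) := by
  classical
  obtain ⟨s, hs⟩ := Module.projective_def'.1 hproj
  have hsum : ∀ x : P, ∑ a, e a • x = x := fun x => by
    rw [← Finset.sum_smul, h.complete, one_smul]
  have hex : ({a | ∃ x : P, e a • x ≠ 0} : Set n).Nonempty := by
    by_contra hemp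
    rw [Set.not_nonempty_iff_eq_empty, Set.eq_empty_iff_forall_notMem] at hemp
    refine hP.1 (ModuleCat.isZero_iff_subsingleton.2 ⟨fun x y => ?_⟩)
    have h0 : ∀ x : P, x = 0 := fun x => by
      rw [← hsum x]
      exact Finset.sum_eq_zero fun a _ => not_not.1 fun hx => hemp a ⟨x, hx⟩
    rw [h0 x, h0 y]
  obtain ⟨a, ⟨x₀, hx₀⟩, hmax⟩ := Set.exists_max_image _ r (Set.toFinite _) hex
  set x : P := e a • x₀ with hx
  have hax : e a • x = x := by rw [hx, ← mul_smul, (h.idem a).eq]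
  have hdual : ∀ p : P, (s p).sum (fun i c => c • i) = p := fun p => LinearMap.congr_fun hs p
  have hcoef : ∀ (c : A) (p i : P), s (c • p) i = c * s p i := fun c p i => by simp
  have hi : ∃ i : P, e a * s x i * e a ≠ 0 := by
    by_contra! hno
    apply hx₀
    rw [← hdual x, Finsupp.sum]
    refine Finset.sum_eq_zero fun i _ => ?_
    rw [show s x i • i = ∑ b, s x i • e b • i by rw [← Finset.smul_sum, hsum]]
    refine Finset.sum_eq_zero fun b _ => ?_
    rw [← hax, hcoef, ← mul_smul]
    by_cases hab : a = b
    · subst hab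
      rw [hno i, zero_smul]
    · by_cases h0 : e a * s x i * e b = 0
      · rw [h0, zero_smul]
      · rw [mul_smul]
        have hb : e b • i = 0 := by
          by_contra hb
          exact absurd (hmax b ⟨i, hb⟩) (not_le.2 (h.rank_lt a b _ hab h0))
        rw [hb, smul_zero]
  obtain ⟨i, hi⟩ := hi
  obtain ⟨k, hk⟩ := h.scalar a (s x i)
  have hk0 : k ≠ 0 := by
    rintro rfl
    exact hi (by rw [hk, zero_smul])
  -- The `i`-th coordinate sends `x` to an element whose product with `e a` on the right is `k • e
  -- a`. Dividing by `k` makes `g x = e a`, so that `z ↦ z • x` is a section of `g`.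
  let g : P →ₗ[A] leftIdeal (e a) :=
    { toFun := fun p => ⟨k⁻¹ • (s p i * e a), (mem_leftIdeal (h.idem a)).2 (by
        rw [smul_mul_assoc, mul_assoc, (h.idem a).eq])⟩
      map_add' := fun p q => Subtype.ext (by simp [add_mul])
      map_smul' := fun c p => Subtype.ext (by simp [mul_assoc]) }
  refine ⟨a, nonempty_iso_of_retraction (h.ne_zero a) hP g
    ((LinearMap.toSpanSingleton A P x).comp (leftIdeal (e a)).subtype) fun z => Subtype.ext ?_⟩
  change k⁻¹ • (s (z.1 • x) i * e a) = z.1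
  have hz := (mem_leftIdeal (h.idem a)).1 z.2
  rw [hcoef]
  conv_lhs => rw [← hz]
  have hxa : e a * s x i = s x i := by rw [← hcoef, hax]
  rw [mul_assoc z.1, mul_assoc z.1, hk, mul_smul_comm, hz, smul_smul, inv_mul_cancel₀ hk0, one_smul]

end Modules

/-! ### The Coxeter polynomial in terms of Peirce components -/

section Coxeter

variable {K : Type w} [Field K] {A : Type u} [Ring A] [Algebra K A] {n : Type*} [Fintype n]
  {e : n → A} {r : n → ℤ}

/-- The indecomposable projective right module corresponding to an idempotent. -/
def IsDirected.proj (h : IsDirected K e r) (a : n) : IndecProj A :=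
  ⟨projModule (MulOpposite.op (e a)), inferInstanceAs (Module.Finite _ (leftIdeal _)),
    projective_leftIdeal (h.op.idem a), h.op.indecomposable a⟩

/-- The isomorphism classes of indecomposable projective right modules of a directed algebra
correspond to the idempotents. -/
noncomputable def IsDirected.equivClass (h : IsDirected K e r) : n ≃ IndecProjClass A :=
  Equiv.ofBijective (fun a => Quotient.mk (indecProjSetoid A) (h.proj a)) <| by
    refine ⟨fun a b hab => ?_, fun i => ?_⟩
    · obtain ⟨f⟩ := Quotient.exact hab
      exact h.op.eq_of_iso f
    · induction i using Quotient.inductionOn with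
      | h P =>
        obtain ⟨a, ⟨f⟩⟩ := h.op.exists_iso_projModule P.2.2.1 P.2.2.2
        exact ⟨a, Quotient.sound ⟨f.symm⟩⟩

theorem IsDirected.nonempty_rep_iso (h : IsDirected K e r) (a : n) :
    Nonempty ((h.equivClass a).rep ≅ projModule (MulOpposite.op (e a))) :=
  Quotient.mk_out (s := indecProjSetoid A) (h.proj a)

/-- Homomorphisms from `e a A` to `e b A` are left multiplications by elements of `e b A e a`; this
is why the two indices are exchanged. -/
theorem IsDirected.cartanMatrix_apply (h : IsDirected K e r) (a b : n) :
    cartanMatrix K A (h.equivClass a) (h.equivClass b) =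
      Module.finrank K (peirce K (e b) (e a)) := by
  obtain ⟨f⟩ := h.nonempty_rep_iso a
  obtain ⟨g⟩ := h.nonempty_rep_iso b
  have h1 := (Linear.homCongr K f g).finrank_eq
  have h2 := (projModuleHomEquiv (K := K) (h.op.idem a) (h.op.idem b)).finrank_eq
  have h3 : Module.finrank K (peirce K (MulOpposite.op (e a)) (MulOpposite.op (e b))) =
      Module.finrank K (peirce K (e b) (e a)) := by
    refine (LinearEquiv.finrank_eq ((MulOpposite.opLinearEquiv K).submoduleMap
      (peirce K (e b) (e a)) ≪≫ₗ LinearEquiv.ofEq _ _ ?_)).symm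
    ext x
    simp only [Submodule.mem_map, mem_peirce]
    constructor
    · rintro ⟨_, ⟨y, rfl⟩, rfl⟩
      exact ⟨MulOpposite.op y, by simp [mul_assoc]⟩
    · rintro ⟨y, rfl⟩
      exact ⟨_, ⟨y.unop, rfl⟩, by simp [mul_assoc]⟩
  unfold cartanMatrix
  rw [h1, h2, h3]

/-- The polynomial `det (x M + Mᵀ)` of an integral matrix `M`. -/
noncomputable def coxeterDet {n : Type*} [Fintype n] [DecidableEq n] (M : Matrix n n ℤ) : ℤ[X] :=
  ((X : ℤ[X]) • M.map (Polynomial.C : ℤ →+* ℤ[X]) +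
    (M.map (Polynomial.C : ℤ →+* ℤ[X])).transpose).det

theorem coxeterDet_reindex {n m : Type*} [Fintype n] [DecidableEq n] [Fintype m] [DecidableEq m]
    (f : n ≃ m) (M : Matrix m m ℤ) : coxeterDet (M.submatrix f f) = coxeterDet M := by
  unfold coxeterDet
  rw [← Matrix.det_submatrix_equiv_self f]
  rfl

theorem IsDirected.coxeterPolynomial_eq [DecidableEq n] (h : IsDirected K e r) :
    coxeterPolynomial K A =
      coxeterDet (Matrix.of fun a b => (Module.finrank K (peirce K (e b) (e a)) : ℤ)) := by
  classical
  have hfin : Finite (IndecProjClass A) := Finite.of_equiv n h.equivClass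
  have hM : (Matrix.of fun a b => (Module.finrank K (peirce K (e b) (e a)) : ℤ)) =
      (cartanMatrix K A).submatrix h.equivClass h.equivClass := by
    ext a b
    exact (h.cartanMatrix_apply a b).symm
  rw [hM]
  unfold coxeterPolynomial
  rw [dif_pos hfin]
  let : Fintype (IndecProjClass A) := @Fintype.ofFinite _ hfin
  rw [coxeterDet_reindex]
  unfold coxeterDet
  congr!

end Coxeter

/-! ### A criterion for relation ideals -/

section RelationIdeal

variable {K : Type*} [Field K] {Q : Type*} [Quiver Q] [Fintype Q]

/-- An ideal is generated by linear combinations of parallel paths of lengths at least `2` if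
all linear combinations of parallel paths in it are of this kind. -/
theorem isRelationIdeal_of_length {I : TwoSidedIdeal (PathAlgebra K Q)}
    (h : ∀ (a b : Q) (x : Quiver.Path a b →₀ K), PathAlgebra.of x ∈ I →
      ∀ p ∈ x.support, 2 ≤ p.length) : IsRelationIdeal I := by
  refine ⟨{z | z ∈ I ∧ ∃ (a b : Q) (x : Quiver.Path a b →₀ K), z = PathAlgebra.of x}, ?_, ?_⟩
  · rintro _ ⟨hz, a, b, x, rfl⟩
    exact ⟨a, b, x, h a b x hz, rfl⟩
  · refine le_antisymm (fun z hz => ?_) (TwoSidedIdeal.span_le.2 fun z hz => hz.1)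
    rw [PathAlgebra.mem_iff_of_mem]
    exact fun a b => TwoSidedIdeal.subset_span
      ⟨(PathAlgebra.mem_iff_of_mem I z).1 hz a b, a, b, _, rfl⟩

end RelationIdeal

/-! ### The Gabriel quiver: directed algebras are triangular -/

section GabrielQuiver

/-- Used for components of the radical and of its square, where `W` spans the arrows. A complement
of `J' ⊓ J` is cut down to `J`, so no inclusion of `J'` in `J` has to be known. -/
theorem exists_relative_complement {K V : Type*} [Field K] [AddCommGroup V] [Module K V]
    (J J' : Submodule K V) : ∃ W ≤ J, Disjoint W J' ∧ J ≤ W ⊔ J' := by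
  obtain ⟨C, hC⟩ := Submodule.exists_isCompl (J' ⊓ J)
  refine ⟨C ⊓ J, inf_le_right, ?_, ?_⟩
  · rw [disjoint_iff, inf_assoc, inf_comm J J']
    exact hC.symm.inf_eq_bot
  · intro x hx
    have htop : x ∈ (J' ⊓ J) ⊔ C := by rw [hC.sup_eq_top]; trivial
    obtain ⟨y, hy, z, hz, rfl⟩ := Submodule.mem_sup.1 htop
    rw [add_comm]
    refine Submodule.add_mem_sup ⟨hz, ?_⟩ hy.1
    simpa using J.sub_mem hx hy.2

variable {K : Type u} [Field K] {A : Type u} [Ring A] [Algebra K A] {n : Type u}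

/-- The quiver with vertices `n` and arrows given by bases of the subspaces `W a b`. -/
def GabrielQuiver (_ : n → n → Submodule K A) : Type u := n

instance (W : n → n → Submodule K A) : Quiver.{u} (GabrielQuiver W) where
  Hom a b := ULift.{u} (Fin (Module.finrank K (W a b)))

instance (W : n → n → Submodule K A) [Fintype n] : Fintype (GabrielQuiver W) :=
  inferInstanceAs (Fintype n)

instance (W : n → n → Submodule K A) (a b : GabrielQuiver W) : Finite (a ⟶ b) :=
  inferInstanceAs (Finite (ULift _))

namespace GabrielQuiver

variable {W : n → n → Submodule K A} [FiniteDimensional K A]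

/-- The element of the algebra corresponding to an arrow. -/
noncomputable def ofArrow {a b : GabrielQuiver W} (α : a ⟶ b) : A :=
  (Module.finBasis K (W a b) α.down : W a b)

theorem ofArrow_mem {a b : GabrielQuiver W} (α : a ⟶ b) : ofArrow α ∈ W a b :=
  (Module.finBasis K (W a b) α.down).2

/-- The element of the algebra corresponding to a path. -/
noncomputable def evalPath (e : n → A) {a : GabrielQuiver W} :
    ∀ {b : GabrielQuiver W}, Quiver.Path a b → A
  | _, .nil => e a
  | _, .cons p α => evalPath e p * ofArrow α

variable {e : n → A} {r : n → ℤ}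

theorem ofArrow_ne_zero {a b : GabrielQuiver W} (α : a ⟶ b) : ofArrow α ≠ 0 := fun h0 =>
  (Module.finBasis K (W a b)).ne_zero α.down (Subtype.ext h0)

theorem linearIndependent_ofArrow (a b : GabrielQuiver W) :
    LinearIndependent K (fun α : a ⟶ b => ofArrow α) := by
  have h1 := (Module.finBasis K (W a b)).linearIndependent.map' (W a b).subtype
    (Submodule.ker_subtype _)
  exact h1.comp ULift.down ULift.down_injective

theorem evalPath_nil (a : GabrielQuiver W) :
    evalPath e (Quiver.Path.nil : Quiver.Path a a) = e a := rfl

theorem evalPath_cons {a b c : GabrielQuiver W} (p : Quiver.Path a b) (α : b ⟶ c) :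
    evalPath e (p.cons α) = evalPath e p * ofArrow α := rfl

end GabrielQuiver

open Classical in
variable (K) in
/-- The component between `e a` and `e b` of the radical of a directed algebra. -/
noncomputable def radComponent (e : n → A) (a b : n) : Submodule K A :=
  if a = b then ⊥ else peirce K (e a) (e b)

variable (K) in
/-- The component between `e a` and `e b` of the square of the radical of a directed algebra. -/
noncomputable def radSqComponent (e : n → A) (a b : n) : Submodule K A :=
  ⨆ c, radComponent K e a c * radComponent K e c b

variable {e : n → A} {r : n → ℤ}

theorem mem_radComponent {a b : n} (hab : a ≠ b) {x : A} :
    x ∈ radComponent K e a b ↔ x ∈ peirce K (e a) (e b) := by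
  rw [radComponent, if_neg hab]

theorem radComponent_le_peirce (a b : n) : radComponent K e a b ≤ peirce K (e a) (e b) := by
  unfold radComponent
  split_ifs
  · exact bot_le
  · exact le_rfl

theorem ne_of_mem_radComponent {a b : n} {x : A} (hx : x ∈ radComponent K e a b) (h0 : x ≠ 0) :
    a ≠ b := by
  rintro rfl
  rw [radComponent, if_pos rfl] at hx
  exact h0 hx

theorem mul_mem_radSqComponent {a b c : n} {x y : A} (hx : x ∈ radComponent K e a c)
    (hy : y ∈ radComponent K e c b) : x * y ∈ radSqComponent K e a b :=
  (le_iSup (fun c => radComponent K e a c * radComponent K e c b) c)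
    (Submodule.mul_mem_mul hx hy)

variable [Fintype n]

theorem IsDirected.rank_lt_of_mem (h : IsDirected K e r) {a b : n} {x : A}
    (hx : x ∈ radComponent K e a b) (h0 : x ≠ 0) : r a < r b := by
  obtain ⟨y, rfl⟩ := mem_peirce.1 (radComponent_le_peirce a b hx)
  exact h.rank_lt a b y (ne_of_mem_radComponent hx h0) h0

namespace GabrielQuiver

variable {W : n → n → Submodule K A} [FiniteDimensional K A]
  (h : IsDirected K e r) (hW : ∀ a b, W a b ≤ radComponent K e a b)

include h hW

theorem rank_lt_of_arrow {a b : GabrielQuiver W} (α : a ⟶ b) : r a < r b :=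
  h.rank_lt_of_mem (hW _ _ (ofArrow_mem α)) (ofArrow_ne_zero α)

theorem rank_le_of_path {a b : GabrielQuiver W} (p : Quiver.Path a b) : r a ≤ r b := by
  induction p with
  | nil => exact le_rfl
  | cons p α ih => exact ih.trans (rank_lt_of_arrow h hW α).le

theorem rank_lt_of_cons {a b c : GabrielQuiver W} (p : Quiver.Path a b) (α : b ⟶ c) : r a < r c :=
  (rank_le_of_path h hW p).trans_lt (rank_lt_of_arrow h hW α)

theorem isAcyclic : IsAcyclic (GabrielQuiver W) := by
  intro a p
  cases p with
  | nil => rfl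
  | cons p α => exact absurd (rank_lt_of_cons h hW p α) (lt_irrefl _)

theorem evalPath_mem {a b : GabrielQuiver W} (p : Quiver.Path a b) :
    evalPath e p ∈ peirce K (e a) (e b) := by
  induction p with
  | nil =>
    have := mul_mul_mem_peirce (K := K) (e a) (e a) 1
    rwa [mul_one, (h.idem a).eq] at this
  | cons p α ih =>
    exact mul_mem_peirce (h.idem _) (h.idem _) ih
      (radComponent_le_peirce _ _ (hW _ _ (ofArrow_mem α)))

theorem evalPath_comp {a b c : GabrielQuiver W} (p : Quiver.Path a b) (q : Quiver.Path b c) :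
    evalPath e (p.comp q) = evalPath e p * evalPath e q := by
  induction q with
  | nil => exact (mul_eq_of_mem_peirce' (h.idem b) (evalPath_mem h hW p)).symm
  | cons q α ih => rw [Quiver.Path.comp_cons, evalPath_cons, ih, mul_assoc, evalPath_cons]

theorem evalPath_mul_ne {a b b' c : GabrielQuiver W} (p : Quiver.Path a b)
    (q : Quiver.Path b' c) (hb : b ≠ b') : evalPath e p * evalPath e q = 0 := by
  rw [← mul_eq_of_mem_peirce' (h.idem b) (evalPath_mem h hW p),
    ← mul_eq_of_mem_peirce (h.idem b') (evalPath_mem h hW q), mul_assoc, ← mul_assoc (e b),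
    show e b * e b' = 0 from h.ortho hb, zero_mul, mul_zero]

theorem evalPath_toPath {a b : GabrielQuiver W} (α : a ⟶ b) :
    evalPath e α.toPath = ofArrow α := by
  rw [Quiver.Hom.toPath, evalPath_cons, evalPath_nil]
  exact mul_eq_of_mem_peirce (h.idem a) (radComponent_le_peirce _ _ (hW _ _ (ofArrow_mem α)))

/-- Split off the last arrow. What remains still contains an arrow, so it raises the rank, joins
different vertices and evaluates into the radical. -/
theorem evalPath_mem_radSq {a b : GabrielQuiver W} (p : Quiver.Path a b) (hp : 2 ≤ p.length) :
    evalPath e p ∈ radSqComponent K e a b := by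
  cases p with
  | nil => simp at hp
  | cons p β =>
    cases p with
    | nil => simp at hp
    | cons p α =>
      refine mul_mem_radSqComponent ?_ (hW _ _ (ofArrow_mem β))
      refine (mem_radComponent fun hac => ?_).2 (evalPath_mem h hW _)
      have := rank_lt_of_cons h hW p α
      rw [hac] at this
      exact lt_irrefl _ this

/-- The algebra homomorphism from the path algebra. -/
noncomputable def evalHom : PathAlgebra K (GabrielQuiver W) →ₐ[K] A :=
  PathAlgebra.lift (fun _ _ p => evalPath e p) h.complete
    (fun _ _ _ p q => evalPath_comp h hW p q) (fun _ _ _ _ p q hb => evalPath_mul_ne h hW p q hb)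

theorem evalHom_of {a b : GabrielQuiver W} (x : Quiver.Path a b →₀ K) :
    evalHom h hW (PathAlgebra.of x) = Finsupp.linearCombination K (evalPath e) x :=
  PathAlgebra.linearLift_of _ x

theorem evalPath_mem_range {a b : GabrielQuiver W} (p : Quiver.Path a b) :
    evalPath e p ∈ (evalHom h hW).range :=
  ⟨PathAlgebra.ofPath p, by
    change evalHom h hW _ = _
    rw [PathAlgebra.ofPath, evalHom_of, Finsupp.linearCombination_single, one_smul]⟩

theorem ofArrow_mem_range {a b : GabrielQuiver W} (α : a ⟶ b) :
    ofArrow α ∈ (evalHom h hW).range := by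
  rw [← evalPath_toPath h hW α]
  exact evalPath_mem_range h hW _

theorem le_range (a b : n) : W a b ≤ Subalgebra.toSubmodule (evalHom h hW).range := by
  intro x hx
  have hx' := (Module.finBasis K (W a b)).sum_repr ⟨x, hx⟩
  rw [← show _ = x from congrArg Subtype.val hx', Submodule.coe_sum]
  refine Submodule.sum_mem _ fun i _ => Submodule.smul_mem _ _ ?_
  let α : @Quiver.Hom (GabrielQuiver W) _ a b := ⟨i⟩
  exact ofArrow_mem_range h hW α

/-- Induction on a bound for the rank difference. A negative difference makes the component vanish.
Otherwise a radical element is a combination of arrows plus products of radical elements, and the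
factors of a nonzero product have smaller rank differences. -/
theorem peirce_le_range (hW' : ∀ a b, radComponent K e a b ≤ W a b ⊔ radSqComponent K e a b)
    (N : ℕ) : ∀ a b : n, r b - r a < N →
      peirce K (e a) (e b) ≤ Subalgebra.toSubmodule (evalHom h hW).range := by
  induction N with
  | zero =>
    intro a b hab x hx
    by_cases h0 : x = 0
    · rw [h0]
      exact Submodule.zero_mem _
    · exfalso
      obtain ⟨y, rfl⟩ := mem_peirce.1 hx
      by_cases hne : a = b
      · subst hne
        simp at hab
      · have := h.rank_lt a b y hne h0
        push_cast at hab
        linarith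
  | succ N ih =>
    intro a b hab
    by_cases hne : a = b
    · subst hne
      intro x hx
      obtain ⟨y, rfl⟩ := mem_peirce.1 hx
      obtain ⟨k, hk⟩ := h.scalar a y
      rw [hk]
      exact Submodule.smul_mem _ _
        (evalPath_mem_range h hW (Quiver.Path.nil : @Quiver.Path (GabrielQuiver W) _ a a))
    · have hJ : radComponent K e a b = peirce K (e a) (e b) := if_neg hne
      rw [← hJ]
      refine (hW' a b).trans (sup_le (le_range h hW a b) (iSup_le fun c => ?_))
      rw [Submodule.mul_le]
      intro x hx y hy
      by_cases hx0 : x = 0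
      · rw [hx0, zero_mul]
        exact Submodule.zero_mem _
      by_cases hy0 : y = 0
      · rw [hy0, mul_zero]
        exact Submodule.zero_mem _
      have h1 := h.rank_lt_of_mem hx hx0
      have h2 := h.rank_lt_of_mem hy hy0
      push_cast at hab
      exact (evalHom h hW).range.mul_mem
        (ih a c (by linarith) (radComponent_le_peirce _ _ hx))
        (ih c b (by linarith) (radComponent_le_peirce _ _ hy))

theorem evalHom_surjective
    (hW' : ∀ a b, radComponent K e a b ≤ W a b ⊔ radSqComponent K e a b) :
    Function.Surjective (evalHom h hW) := by
  intro x
  change x ∈ Subalgebra.toSubmodule (evalHom h hW).range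
  have hx : x = ∑ a, ∑ b, e a * x * e b := by
    simp_rw [← Finset.mul_sum, h.complete, mul_one, ← Finset.sum_mul, h.complete, one_mul]
  rw [hx]
  refine Submodule.sum_mem _ fun a _ => Submodule.sum_mem _ fun b _ => ?_
  exact peirce_le_range h hW hW' ((r b - r a).toNat + 1) a b
    (by push_cast; linarith [Int.self_le_toNat (r b - r a)]) (mul_mul_mem_peirce _ _ _)

/-- If `a = b`, only the trivial path occurs and `e a ≠ 0`. If `a ≠ b`, the arrows in `x` evaluate
into `W a b` and the longer paths into the square of the radical. These spaces are disjoint, so the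
arrow part evaluates to zero, and its coefficients vanish by the independence of the arrows. -/
theorem length_of_evalHom_eq_zero (hdisj : ∀ a b, Disjoint (W a b) (radSqComponent K e a b))
    {a b : GabrielQuiver W} (x : Quiver.Path a b →₀ K)
    (hx : evalHom h hW (PathAlgebra.of x) = 0) : ∀ p ∈ x.support, 2 ≤ p.length := by
  classical
  rw [evalHom_of] at hx
  intro p hp
  by_contra! hlt
  rw [Finsupp.mem_support_iff] at hp
  by_cases hab : a = b
  · subst hab
    have hnil : ∀ q : Quiver.Path a a, q = Quiver.Path.nil := isAcyclic h hW a
    have hx1 : x = Finsupp.single Quiver.Path.nil (x Quiver.Path.nil) := by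
      ext q
      rw [hnil q, Finsupp.single_eq_same]
    rw [hx1, Finsupp.linearCombination_single, evalPath_nil] at hx
    rcases smul_eq_zero.1 hx with h0 | h0
    · exact hp (by rw [hnil p, h0])
    · exact h.ne_zero a h0
  have hlen : ∀ q : Quiver.Path a b, q.length ≠ 0 := fun q hq =>
    hab (Quiver.Path.eq_of_length_zero q hq)
  set f : (a ⟶ b) → Quiver.Path a b := fun α => α.toPath with hf
  have hfinj : Function.Injective f := fun α β hαβ => by
    simpa [hf, Quiver.Hom.toPath] using hαβ
  set x₁ := x.filter (fun q => q.length = 1) with hx₁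
  set x₂ := x.filter (fun q => ¬ q.length = 1) with hx₂
  have hsum : x₁ + x₂ = x := Finsupp.filter_add_filter_not _ _
  have hmem₂ : Finsupp.linearCombination K (evalPath e) x₂ ∈ radSqComponent K e a b := by
    rw [Finsupp.linearCombination_apply, Finsupp.sum]
    refine Submodule.sum_mem _ fun q hq => Submodule.smul_mem _ _ (evalPath_mem_radSq h hW q ?_)
    have h1 : ¬ q.length = 1 := (Finsupp.mem_support_iff.1 hq |> fun h2 => by
      by_contra h3
      exact h2 (Finsupp.filter_apply_neg _ _ (not_not.2 h3)))
    have := hlen q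
    omega
  have hrange : (x₁.support : Set (Quiver.Path a b)) ⊆ Set.range f := by
    intro q hq
    have h1 : q.length = 1 := by
      by_contra h3
      exact Finsupp.mem_support_iff.1 hq (Finsupp.filter_apply_neg _ _ h3)
    cases q with
    | nil => simp at h1
    | cons q α =>
      have h2 : q.length = 0 := by simpa using h1
      cases q with
      | nil => exact ⟨α, rfl⟩
      | cons q β => simp at h2
  have hmap := Finsupp.mapDomain_comapDomain f hfinj x₁ hrange
  set φ := Finsupp.comapDomain f x₁ hfinj.injOn
  have heval : Finsupp.linearCombination K (evalPath e) x₁ =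
      Finsupp.linearCombination K (fun α : a ⟶ b => ofArrow α) φ := by
    rw [← hmap, Finsupp.linearCombination_mapDomain]
    congr 2
    funext α
    exact evalPath_toPath h hW α
  have hmem₁ : Finsupp.linearCombination K (evalPath e) x₁ ∈ W a b := by
    rw [heval, Finsupp.linearCombination_apply, Finsupp.sum]
    exact Submodule.sum_mem _ fun α _ => Submodule.smul_mem _ _ (ofArrow_mem α)
  have hzero : Finsupp.linearCombination K (evalPath e) x₁ = 0 := by
    refine Submodule.disjoint_def.1 (hdisj a b) _ hmem₁ ?_
    have : Finsupp.linearCombination K (evalPath e) x₁ =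
        -Finsupp.linearCombination K (evalPath e) x₂ := by
      rw [eq_neg_iff_add_eq_zero, ← map_add, hsum, hx]
    rw [this]
    exact Submodule.neg_mem _ hmem₂
  have hφ : φ = 0 := by
    rw [heval] at hzero
    exact linearIndependent_iff.1 (linearIndependent_ofArrow a b) φ hzero
  have hp1 : p.length = 1 := by
    have := hlen p
    omega
  apply hp
  rw [← Finsupp.filter_apply_pos (fun q : Quiver.Path a b => q.length = 1) x hp1, ← hx₁, ← hmap,
    hφ]
  simp

end GabrielQuiver

/-- A finite-dimensional directed algebra is triangular. -/
theorem IsDirected.isTriangular [FiniteDimensional K A] (h : IsDirected K e r) :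
    IsTriangular K A := by
  -- The complements of the square of the radical in the radical provide the arrows. Being a
  -- complement has two uses: spanning gives surjectivity, disjointness excludes short relations.
  choose W hW hdisj hW' using fun a b =>
    exists_relative_complement (radComponent K e a b) (radSqComponent K e a b)
  refine ⟨GabrielQuiver W, inferInstance, inferInstance,
    TwoSidedIdeal.ker (GabrielQuiver.evalHom h hW), inferInstance,
    GabrielQuiver.isAcyclic h hW, isRelationIdeal_of_length fun a b x hx => ?_, ?_⟩
  · exact GabrielQuiver.length_of_evalHom_eq_zero h hW hdisj x (TwoSidedIdeal.mem_ker _ |>.1 hx)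
  · obtain ⟨f⟩ := nonempty_quotAlg_equiv (TwoSidedIdeal.ker (GabrielQuiver.evalHom h hW))
      (GabrielQuiver.evalHom h hW) (GabrielQuiver.evalHom_surjective h hW hW')
      (fun z => (TwoSidedIdeal.mem_ker _).symm)
    exact ⟨f.symm⟩

end GabrielQuiver

/-! ### Lengths of paths in a relation ideal -/

section Lengths

variable {K : Type*} [Field K] {Q : Type*} [Quiver Q]

theorem PathAlgebra.exists_of_concat_ne_zero {a b c : Q} {x : Quiver.Path a b →₀ K}
    {y : Quiver.Path b c →₀ K} {r : Quiver.Path a c} (h : PathAlgebra.concat x y r ≠ 0) :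
    ∃ p ∈ x.support, ∃ q ∈ y.support, p.comp q = r := by
  classical
  by_contra! hno
  apply h
  unfold PathAlgebra.concat
  rw [Finsupp.sum_apply, Finsupp.sum]
  refine Finset.sum_eq_zero fun p hp => ?_
  rw [Finsupp.sum_apply, Finsupp.sum]
  refine Finset.sum_eq_zero fun q hq => ?_
  rw [Finsupp.single_apply, if_neg (hno p hp q hq)]

variable [Fintype Q]

variable (K Q) in
/-- The ideal of the path algebra spanned by all paths of length at least `m`. -/
noncomputable def lengthIdeal (m : ℕ) : TwoSidedIdeal (PathAlgebra K Q) :=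
  TwoSidedIdeal.mk' {z | ∀ (a b : Q) (p : Quiver.Path a b), p.length < m → z a b p = 0}
    (fun _ _ _ _ => rfl)
    (fun {x y} hx hy a b p hp => by
      rw [PathAlgebra.add_apply, Finsupp.add_apply, hx a b p hp, hy a b p hp, add_zero])
    (fun {x} hx a b p hp => by
      change -(x a b p) = 0
      rw [hx a b p hp, neg_zero])
    (fun {x y} hy a c p hp => by
      rw [PathAlgebra.mul_apply, Finsupp.finsetSum_apply]
      refine Finset.sum_eq_zero fun b _ => ?_
      by_contra h0
      obtain ⟨q, -, q', hq', rfl⟩ := PathAlgebra.exists_of_concat_ne_zero h0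
      rw [Quiver.Path.length_comp] at hp
      exact Finsupp.mem_support_iff.1 hq' (hy b c q' (by omega)))
    (fun {x y} hx a c p hp => by
      rw [PathAlgebra.mul_apply, Finsupp.finsetSum_apply]
      refine Finset.sum_eq_zero fun b _ => ?_
      by_contra h0
      obtain ⟨q, hq, q', -, rfl⟩ := PathAlgebra.exists_of_concat_ne_zero h0
      rw [Quiver.Path.length_comp] at hp
      exact Finsupp.mem_support_iff.1 hq (hx a b q (by omega)))

theorem mem_lengthIdeal {m : ℕ} {z : PathAlgebra K Q} :
    z ∈ lengthIdeal K Q m ↔ ∀ (a b : Q) (p : Quiver.Path a b), p.length < m → z a b p = 0 :=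
  TwoSidedIdeal.mem_mk' ..

/-- The generators lie in the ideal spanned by the paths of length at least `2`, hence so does
everything they generate. This is the converse of `isRelationIdeal_of_length`. -/
theorem IsRelationIdeal.length {I : TwoSidedIdeal (PathAlgebra K Q)} (hI : IsRelationIdeal I)
    {a b : Q} {x : Quiver.Path a b →₀ K} (hx : PathAlgebra.of x ∈ I) :
    ∀ p ∈ x.support, 2 ≤ p.length := by
  obtain ⟨R, hR, rfl⟩ := hI
  have hle : TwoSidedIdeal.span R ≤ lengthIdeal K Q 2 := by
    rw [TwoSidedIdeal.span_le]
    intro z hz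
    obtain ⟨a, b, y, hy, rfl⟩ := hR z hz
    refine mem_lengthIdeal.2 fun c d p hp => ?_
    by_cases hc : c = a
    · subst hc
      by_cases hd : d = b
      · subst hd
        rw [PathAlgebra.of_apply_self]
        by_contra h0
        exact absurd (hy p (Finsupp.mem_support_iff.2 h0)) (not_le.2 hp)
      · rw [PathAlgebra.of_apply_ne_right _ hd, Finsupp.zero_apply]
    · rw [PathAlgebra.of_apply_ne_left _ hc, Finsupp.zero_apply]
  intro p hp
  by_contra! hlt
  have := mem_lengthIdeal.1 (hle hx) a b p hlt
  rw [PathAlgebra.of_apply_self] at this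
  exact Finsupp.mem_support_iff.1 hp this

end Lengths

/-! ### Acyclic quivers: rank and finiteness -/

section Acyclic

variable {Q : Type*} [Quiver Q]

theorem IsAcyclic.ne_of_arrow (hQ : IsAcyclic Q) {a b : Q} (α : a ⟶ b) : a ≠ b := by
  rintro rfl
  exact Quiver.Path.cons_ne_nil _ _ (hQ a α.toPath)

/-- The number of vertices from which a given vertex can be reached. -/
noncomputable def pathRank (b : Q) : ℤ := ({a : Q | Nonempty (Quiver.Path a b)} : Set Q).ncard

variable [Fintype Q]

/-- Along a path the set of predecessors can only grow. It grows strictly because `b` precedes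
itself, whereas a path from `b` back to `a` would close an oriented cycle. -/
theorem IsAcyclic.pathRank_lt (hQ : IsAcyclic Q) {a b : Q} (p : Quiver.Path a b) (hab : a ≠ b) :
    pathRank a < pathRank b := by
  unfold pathRank
  rw [Nat.cast_lt]
  refine Set.ncard_lt_ncard ⟨fun c hc => hc.map fun q => q.comp p, fun hsub => ?_⟩
    (Set.toFinite _)
  obtain ⟨q⟩ := hsub (show b ∈ {c : Q | Nonempty (Quiver.Path c b)} from ⟨Quiver.Path.nil⟩)
  have h0 := congrArg Quiver.Path.length (hQ _ (q.comp p))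
  rw [Quiver.Path.length_comp, Quiver.Path.length_nil] at h0
  exact hab (Quiver.Path.eq_of_length_zero p (by omega))

/-- Induction on the rank of the endpoint: a nontrivial path is determined by its last arrow and a
path to a vertex of smaller rank, and there are finitely many choices of both. -/
theorem IsAcyclic.finite_path (hQ : IsAcyclic Q) [∀ a b : Q, Finite (a ⟶ b)] (a b : Q) :
    Finite (Quiver.Path a b) := by
  have key : ∀ N : ℕ, ∀ b : Q, pathRank b < N → Finite (Quiver.Path a b) := by
    intro N
    induction N with
    | zero =>
      intro b hb
      exact absurd hb (not_lt.2 (by unfold pathRank; positivity))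
    | succ N ih =>
      intro b hb
      have hfin : ∀ c : {c : Q // Nonempty (c ⟶ b)}, Finite (Quiver.Path a c.1) := by
        rintro ⟨c, ⟨α⟩⟩
        have := hQ.pathRank_lt α.toPath (hQ.ne_of_arrow α)
        push_cast at hb
        exact ih c (by linarith)
      let f : Quiver.Path a b →
          Option (Σ c : {c : Q // Nonempty (c ⟶ b)}, Quiver.Path a c.1 × (c.1 ⟶ b)) :=
        fun p => match p with
          | .nil => none
          | .cons (b := c) q α => some ⟨⟨c, ⟨α⟩⟩, q, α⟩
      refine Finite.of_injective f fun p q hpq => ?_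
      cases p with
      | nil =>
        cases q with
        | nil => rfl
        | cons q β => simp [f] at hpq
      | cons p α =>
        cases q with
        | nil => simp [f] at hpq
        | cons q β =>
          simp only [f, Option.some.injEq] at hpq
          cases hpq
          rfl
  exact key ((pathRank b).toNat + 1) b (by push_cast; linarith [Int.self_le_toNat (pathRank b)])

end Acyclic

/-! ### Triangular algebras are directed -/

section QuotientDirected

variable {K : Type*} [Field K] {Q : Type*} [Quiver Q] [Fintype Q]

/-- The image of a linear combination of parallel paths in the quotient algebra. -/
noncomputable def pathHom (I : TwoSidedIdeal (PathAlgebra K Q)) (a b : Q) :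
    (Quiver.Path a b →₀ K) →ₗ[K] QuotAlg I :=
  (quotMk I).toLinearMap ∘ₗ PathAlgebra.ofₗ K a b

theorem pathHom_apply (I : TwoSidedIdeal (PathAlgebra K Q)) {a b : Q}
    (x : Quiver.Path a b →₀ K) : pathHom I a b x = quotMk I (PathAlgebra.of x) := rfl

theorem idem_mul_quotMk_mul_idem (I : TwoSidedIdeal (PathAlgebra K Q)) (a b : Q)
    (z : PathAlgebra K Q) : idem I a * quotMk I z * idem I b = quotMk I (PathAlgebra.of (z a b)) := by
  rw [← quotMk_vertexIdem, ← quotMk_vertexIdem, ← map_mul, ← map_mul,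
    PathAlgebra.vertexIdem_mul_mul_vertexIdem]

theorem peirce_idem (I : TwoSidedIdeal (PathAlgebra K Q)) (a b : Q) :
    peirce K (idem I a) (idem I b) = LinearMap.range (pathHom I a b) := by
  ext x
  rw [mem_peirce, LinearMap.mem_range]
  constructor
  · rintro ⟨y, rfl⟩
    obtain ⟨z, rfl⟩ := quotMk_surjective I y
    exact ⟨z a b, (idem_mul_quotMk_mul_idem I a b z).symm⟩
  · rintro ⟨x, rfl⟩
    refine ⟨quotMk I (PathAlgebra.of x), ?_⟩
    rw [idem_mul_quotMk_mul_idem, PathAlgebra.of_apply_self, pathHom_apply]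

/-- Acyclicity leaves only the trivial path from `a` to `a` and makes `pathRank` increase along the
others. The trivial paths survive in the quotient because they are too short to lie in `I`. -/
theorem isDirected_idem (hQ : IsAcyclic Q) {I : TwoSidedIdeal (PathAlgebra K Q)}
    (hI : IsRelationIdeal I) : IsDirected K (idem I) pathRank where
  idem := isIdempotentElem_idem I
  ortho a b hab := by
    change idem I a * idem I b = 0
    rw [← quotMk_vertexIdem, ← quotMk_vertexIdem, ← map_mul, PathAlgebra.vertexIdem,
      PathAlgebra.vertexIdem, PathAlgebra.ofPath_mul_ofPath_ne hab, map_zero]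
  complete := by
    rw [← map_one (quotMk I), PathAlgebra.one_eq_sum, map_sum]
    rfl
  ne_zero a h0 := by
    have h1 : PathAlgebra.of (Finsupp.single (Quiver.Path.nil : Quiver.Path a a) (1 : K)) ∈ I :=
      (quotMk_eq_zero_iff I _).1 h0
    have := hI.length h1 Quiver.Path.nil (by simp)
    simp at this
  scalar a x := by
    obtain ⟨z, rfl⟩ := quotMk_surjective I x
    refine ⟨z a a Quiver.Path.nil, ?_⟩
    have hz : z a a = Finsupp.single Quiver.Path.nil (z a a Quiver.Path.nil) := by
      ext q
      rw [hQ a q, Finsupp.single_eq_same]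
    rw [idem_mul_quotMk_mul_idem, hz, PathAlgebra.of_single, map_smul, ← quotMk_vertexIdem,
      PathAlgebra.vertexIdem, Finsupp.single_eq_same]
  rank_lt a b x hab hx := by
    obtain ⟨z, rfl⟩ := quotMk_surjective I x
    rw [idem_mul_quotMk_mul_idem] at hx
    by_cases hp : Nonempty (Quiver.Path a b)
    · exact hQ.pathRank_lt hp.some hab
    · rw [not_nonempty_iff] at hp
      rw [Subsingleton.elim (z a b) 0, PathAlgebra.of_zero, map_zero] at hx
      exact absurd rfl hx

theorem finiteDimensional_quotAlg (hQ : IsAcyclic Q) [∀ a b : Q, Finite (a ⟶ b)]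
    (I : TwoSidedIdeal (PathAlgebra K Q)) : FiniteDimensional K (QuotAlg I) := by
  have := hQ.finite_path
  have : FiniteDimensional K (PathAlgebra K Q) :=
    inferInstanceAs (FiniteDimensional K (∀ a b : Q, Quiver.Path a b →₀ K))
  exact Module.Finite.of_surjective (quotMk I).toLinearMap (quotMk_surjective I)

/-- Each range is the quotient by a kernel, and `E` matches the kernels. This compares Peirce
components of two algebras between which there need not be a homomorphism. -/
theorem finrank_range_eq_of_ker_eq {V V' U U' : Type*} [AddCommGroup V] [Module K V]
    [AddCommGroup V'] [Module K V'] [AddCommGroup U] [Module K U] [AddCommGroup U'] [Module K U']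
    (f : V →ₗ[K] U) (f' : V' →ₗ[K] U') (E : V ≃ₗ[K] V') (h : ∀ x, f x = 0 ↔ f' (E x) = 0) :
    Module.finrank K (LinearMap.range f) = Module.finrank K (LinearMap.range f') := by
  rw [← f.quotKerEquivRange.finrank_eq, ← f'.quotKerEquivRange.finrank_eq]
  refine (Submodule.Quotient.equiv _ _ E ?_).finrank_eq
  ext y
  rw [Submodule.mem_map]
  constructor
  · rintro ⟨x, hx, rfl⟩
    exact (h x).1 hx
  · intro hy
    refine ⟨E.symm y, (h _).2 ?_, E.apply_symm_apply y⟩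
    rw [E.apply_symm_apply]
    exact hy

end QuotientDirected

/-! ### The corner algebra is directed -/

section CornerDirected

variable {K : Type*} [Field K] {A : Type*} [Ring A] [Algebra K A] {n : Type*} [Fintype n]
  {e : n → A} {r : n → ℤ}

variable (K) in
/-- The inclusion of a corner ring, as a linear map. -/
def cornerSubtype {f : A} (hf : IsIdempotentElem f) : hf.Corner →ₗ[K] A where
  toFun := Subtype.val
  map_add' _ _ := rfl
  map_smul' _ _ := rfl

theorem IsDirected.sub_mul (h : IsDirected K e r) {v a : n} (ha : a ≠ v) :
    (1 - e v) * e a = e a := by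
  rw [_root_.sub_mul, one_mul, show e v * e a = 0 from h.ortho ha.symm, sub_zero]

theorem IsDirected.mul_sub (h : IsDirected K e r) {v a : n} (ha : a ≠ v) :
    e a * (1 - e v) = e a := by
  rw [_root_.mul_sub, mul_one, show e a * e v = 0 from h.ortho ha, sub_zero]

/-- The idempotents of the corner ring obtained by omitting an idempotent. -/
def IsDirected.cornerIdem (h : IsDirected K e r) {v : n} (hv : IsIdempotentElem (1 - e v))
    (a : {a : n // a ≠ v}) : hv.Corner :=
  ⟨e a.1, (Subsemigroup.mem_corner_iff hv).2 ⟨h.sub_mul a.2, h.mul_sub a.2⟩⟩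

theorem IsDirected.corner (h : IsDirected K e r) {v : n} (hv : IsIdempotentElem (1 - e v))
    [Fintype {a : n // a ≠ v}] : IsDirected K (h.cornerIdem hv) (fun a => r a.1) where
  idem a := Subtype.ext (h.idem a.1)
  ortho a b hab := Subtype.ext (h.ortho fun h0 => hab (Subtype.ext h0))
  complete := by
    classical
    refine Subtype.ext ?_
    change cornerSubtype K hv (∑ a, h.cornerIdem hv a) = 1 - e v
    rw [map_sum]
    change ∑ a : {a : n // a ≠ v}, e a.1 = 1 - e v
    rw [eq_sub_iff_add_eq, ← h.complete, ← Finset.sum_erase_add _ _ (Finset.mem_univ v)]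
    congr 1
    exact (Finset.sum_subtype _ (by simp) e).symm
  ne_zero a h0 := h.ne_zero a.1 (congrArg Subtype.val h0)
  scalar a x := by
    obtain ⟨k, hk⟩ := h.scalar a.1 x.1
    exact ⟨k, Subtype.ext hk⟩
  rank_lt a b x hab hx :=
    h.rank_lt a.1 b.1 x.1 (fun h0 => hab (Subtype.ext h0)) fun h0 => hx (Subtype.ext h0)

/-- The idempotents other than `e v` absorb `1 - e v`, so their components already lie in the corner
and do not change. -/
theorem IsDirected.finrank_peirce_corner (h : IsDirected K e r) {v : n}
    (hv : IsIdempotentElem (1 - e v)) (a b : {a : n // a ≠ v}) :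
    Module.finrank K (peirce K (h.cornerIdem hv a) (h.cornerIdem hv b)) =
      Module.finrank K (peirce K (e a.1) (e b.1)) := by
  refine ((Submodule.equivMapOfInjective (cornerSubtype K hv) Subtype.val_injective _) ≪≫ₗ
    LinearEquiv.ofEq _ _ ?_).finrank_eq
  ext x
  simp only [Submodule.mem_map, mem_peirce]
  constructor
  · rintro ⟨_, ⟨y, rfl⟩, rfl⟩
    exact ⟨y.1, rfl⟩
  · rintro ⟨y, rfl⟩
    have hy : e a.1 * y * e b.1 ∈ Subsemigroup.corner (1 - e v) :=
      (Subsemigroup.mem_corner_iff hv).2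
        ⟨by rw [← mul_assoc, ← mul_assoc, h.sub_mul a.2], by rw [mul_assoc, h.mul_sub b.2]⟩
    refine ⟨⟨_, hy⟩, ⟨⟨_, hy⟩, Subtype.ext ?_⟩, rfl⟩
    exact mul_eq_of_mem_peirce (K := K) (h.idem a.1) (mul_mul_mem_peirce _ _ _) |> fun h1 => by
      change e a.1 * (e a.1 * y * e b.1) * e b.1 = _
      rw [h1, mul_assoc, (h.idem b.1).eq]

theorem finiteDimensional_corner [FiniteDimensional K A] {f : A} (hf : IsIdempotentElem f) :
    FiniteDimensional K hf.Corner :=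
  Module.Finite.of_injective (cornerSubtype K hf) Subtype.val_injective

end CornerDirected

/-- A vertex after an insertion is an old vertex or an element of the inserted poset. -/
theorem InsVertex.old_or_new {Q S : Type*} {v : Q} {P : InsVertex Q v S → Prop}
    (old : ∀ a, P (.old a)) (new : ∀ s, P (.new s)) (x : InsVertex Q v S) : P x :=
  match x with
  | Sum.inl a => old a
  | Sum.inr s => new s

/-! ### Collapsing the inserted poset to the vertex -/

section Projection

variable {Q : Type*} [Quiver Q] {v : Q} {S : Type*} [PartialOrder S]

/-- The map of vertices which collapses the inserted poset to the vertex `v`. -/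
def projVertex : InsVertex Q v S → Q := Sum.elim Subtype.val fun _ => v

/-- The path in `Q` corresponding to an arrow after collapsing the inserted poset. -/
def projArrow {x y : InsVertex Q v S} (α : InsArrow Q v S x y) :
    Quiver.Path (projVertex x) (projVertex y) :=
  match α with
  | .arrow γ => Quiver.Hom.toPath γ
  | .cover _ => Quiver.Path.nil
  | .enter α _ => Quiver.Hom.toPath α
  | .exit _ β => Quiver.Hom.toPath β

/-- The path in `Q` corresponding to a path after collapsing the inserted poset. -/
def projPath {x : InsVertex Q v S} :
    ∀ {y : InsVertex Q v S}, Quiver.Path x y → Quiver.Path (projVertex x) (projVertex y)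
  | _, .nil => .nil
  | _, .cons p α => (projPath p).comp (projArrow α)

theorem projPath_cons {x y z : InsVertex Q v S} (p : Quiver.Path x y) (α : InsArrow Q v S y z) :
    projPath (Quiver.Path.cons p α) = (projPath p).comp (projArrow α) := rfl

theorem projPath_comp {x y z : InsVertex Q v S} (p : Quiver.Path x y) (q : Quiver.Path y z) :
    projPath (p.comp q) = (projPath p).comp (projPath q) := by
  induction q with
  | nil => rfl
  | cons q α ih =>
    rw [Quiver.Path.comp_cons, projPath_cons, ih, Quiver.Path.comp_assoc, projPath_cons]

theorem length_projArrow_le {x y : InsVertex Q v S} (α : InsArrow Q v S x y) :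
    (projArrow α).length ≤ 1 := by
  cases α with
  | cover h => exact Nat.zero_le _
  | _ => exact le_rfl

theorem length_projPath_le {x y : InsVertex Q v S} (p : Quiver.Path x y) :
    (projPath p).length ≤ p.length := by
  induction p with
  | nil => exact le_rfl
  | cons p α ih =>
    rw [projPath_cons, Quiver.Path.length_comp, Quiver.Path.length_cons]
    exact add_le_add ih (length_projArrow_le α)

theorem pathOld_cons {a b c : Deleted Q v} (p : Quiver.Path a b) (α : b ⟶ c) :
    pathOld S (p.cons α) = (pathOld S p).cons (InsArrow.arrow α) := rfl

theorem pathInQ_cons {a b c : Deleted Q v} (p : Quiver.Path a b) (α : b ⟶ c) :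
    pathInQ (p.cons α) = (pathInQ p).cons (α : b.1 ⟶ c.1) := rfl

/-- The extension of a path avoiding `v` by an arrow. -/
def consDeleted {a b c : Deleted Q v} (p : Quiver.Path a b) (α : b.1 ⟶ c.1) : Quiver.Path a c :=
  Quiver.Path.cons p α

theorem projPath_pathOld {a b : Deleted Q v} (p : Quiver.Path a b) :
    projPath (pathOld S p) = pathInQ p := by
  induction p with
  | nil => rfl
  | cons p α ih =>
    rw [pathOld_cons, projPath_cons, ih, pathInQ_cons]
    rfl

theorem projPath_pathNew {x y : S} (q : @Quiver.Path (Hasse S) _ x y) :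
    projPath (pathNew v q) = (Quiver.Path.nil : Quiver.Path v v) := by
  induction q with
  | nil => rfl
  | cons p α ih => exact ih

theorem projPath_insert_pathTo {x : S} (hx : IsMin x) {a : Deleted Q v} (p : PathTo a) :
    projPath (p.insert hx) = p.path :=
  congrArg (fun q => Quiver.Path.cons q p.last) (projPath_pathOld p.init)

theorem projPath_insert_pathFrom {x : S} (hx : IsMax x) {b : Deleted Q v} (p : PathFrom b) :
    projPath (p.insert hx) = p.path := by
  unfold PathFrom.insert PathFrom.path
  rw [projPath_comp, projPath_pathOld]
  rfl

theorem projPath_insert_pathBetween (q : MaximalPath S) {a b : Deleted Q v}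
    (p : PathBetween a b) : projPath (p.insert q) = p.path := by
  cases p with
  | avoid p => exact projPath_pathOld p
  | through p' p'' =>
    change projPath (((p'.insert q.isMin).comp (pathNew v q.path)).comp (p''.insert q.isMax)) =
      p'.path.comp p''.path
    rw [projPath_comp, projPath_comp, projPath_pathNew, projPath_insert_pathTo,
      projPath_insert_pathFrom]
    rfl

/-- Every path from a vertex different from `v` decomposes at `v`. -/
theorem exists_decomposition (hQ : IsAcyclic Q) (a : Deleted Q v) {y : Q}
    (p : Quiver.Path a.1 y) :
    (∀ h : y ≠ v, ∃ c : PathBetween a ⟨y, h⟩, c.path = p) ∧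
      (∀ h : y = v, ∃ c : PathTo a, c.path = h ▸ p) := by
  -- Both statements are proved together: extending a path by an arrow needs one or the other,
  -- according to whether the path so far ends at `v`.
  induction p with
  | nil => exact ⟨fun h => ⟨.avoid .nil, rfl⟩, fun h => absurd h a.2⟩
  | @cons c d p α ih =>
    by_cases hc : c = v
    · obtain ⟨p', hp'⟩ := ih.2 hc
      subst hc
      refine ⟨fun h => ⟨.through p' ⟨⟨d, h⟩, α, .nil⟩, ?_⟩, fun h => ?_⟩
      · change p'.path.comp _ = _
        rw [hp']
        rfl
      · exact absurd h.symm (hQ.ne_of_arrow α)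
    · obtain ⟨p', hp'⟩ := ih.1 hc
      subst hp'
      cases p' with
      | avoid p' =>
        refine ⟨fun h => ⟨.avoid (consDeleted (c := ⟨d, h⟩) p' α), rfl⟩, ?_⟩
        rintro rfl
        exact ⟨⟨⟨c, hc⟩, p', α⟩, rfl⟩
      | through p' p'' =>
        refine ⟨fun h => ⟨.through p' ⟨p''.mid, p''.first,
          consDeleted (c := ⟨d, h⟩) p''.tail α⟩, rfl⟩, ?_⟩
        rintro rfl
        -- Returning to `v` after leaving it would give an oriented cycle.
        exact absurd (hQ _ (p''.path.cons α)) (Quiver.Path.cons_ne_nil _ _)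

theorem exists_pathBetween (hQ : IsAcyclic Q) {a b : Deleted Q v} (p : Quiver.Path a.1 b.1) :
    ∃ c : PathBetween a b, c.path = p :=
  (exists_decomposition hQ a p).1 b.2

theorem exists_pathTo (hQ : IsAcyclic Q) {a : Deleted Q v} (p : Quiver.Path a.1 v) :
    ∃ c : PathTo a, c.path = p :=
  (exists_decomposition hQ a p).2 rfl

theorem exists_pathFrom_aux (hQ : IsAcyclic Q) {y : Q} (p : Quiver.Path v y) (h : y ≠ v) :
    ∃ c : PathFrom (⟨y, h⟩ : Deleted Q v), c.path = p := by
  induction p with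
  | nil => exact absurd rfl h
  | @cons c d p α ih =>
    by_cases hc : c = v
    · subst hc
      rw [hQ _ p]
      exact ⟨⟨⟨d, h⟩, α, .nil⟩, rfl⟩
    · obtain ⟨p', hp'⟩ := ih hc
      subst hp'
      exact ⟨⟨p'.mid, p'.first, consDeleted (c := ⟨d, h⟩) p'.tail α⟩, rfl⟩

theorem exists_pathFrom (hQ : IsAcyclic Q) {b : Deleted Q v} (p : Quiver.Path v b.1) :
    ∃ c : PathFrom b, c.path = p :=
  exists_pathFrom_aux hQ p b.2

end Projection

/-! ### Paths after inserting a chain -/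

section Chain

variable {Q : Type*} [Quiver Q] {v : Q} {k : ℕ}

theorem isMin_fin_iff {x : Fin (k + 1)} : IsMin x ↔ x = 0 :=
  isMin_iff_eq_bot

theorem isMax_fin_iff {x : Fin (k + 1)} : IsMax x ↔ x = Fin.last k :=
  isMax_iff_eq_top

theorem nonempty_chainPath {s t : Fin (k + 1)} (h : s ≤ t) :
    Nonempty (@Quiver.Path (Hasse (Fin (k + 1))) _ s t) := by
  obtain ⟨m, hm⟩ : ∃ m : ℕ, t.1 = s.1 + m := ⟨t.1 - s.1, by have := Fin.le_def.1 h; omega⟩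
  induction m generalizing t with
  | zero =>
    obtain rfl : t = s := Fin.ext (by omega)
    exact ⟨.nil⟩
  | succ m ih =>
    have ht := t.2
    let t' : Fin (k + 1) := ⟨s.1 + m, by omega⟩
    obtain ⟨p⟩ := ih (t := t') (Fin.le_def.2 (Nat.le_add_right _ _)) rfl
    have hcov : t' ⋖ t := by
      refine ⟨Fin.lt_def.2 (by rw [hm]; exact Nat.lt_succ_self _), fun c hc hc' => ?_⟩
      have h1 := Fin.lt_def.1 hc
      have h2 := Fin.lt_def.1 hc'
      change s.1 + m < c.1 at h1
      omega
    exact ⟨Quiver.Path.cons (V := Hasse (Fin (k + 1))) (b := t') p ⟨hcov⟩⟩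

theorem finite_insArrow [∀ a b : Q, Finite (a ⟶ b)] (x y : InsVertex Q v (Fin (k + 1))) :
    Finite (x ⟶ y) := by
  induction x using InsVertex.old_or_new with
  | old a =>
    induction y using InsVertex.old_or_new with
    | old b =>
      refine Finite.of_surjective (fun γ : a.1 ⟶ b.1 => InsArrow.arrow γ) fun (α : InsArrow Q v _ _ _) => ?_
      cases α with
      | arrow γ => exact ⟨γ, rfl⟩
    | new t =>
      refine Finite.of_surjective
        (fun γ : (a.1 ⟶ v) × PLift (IsMin t) => InsArrow.enter γ.1 γ.2.down) fun (α : InsArrow Q v _ _ _) => ?_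
      cases α with
      | enter γ ht => exact ⟨⟨γ, ⟨ht⟩⟩, rfl⟩
  | new s =>
    induction y using InsVertex.old_or_new with
    | old b =>
      refine Finite.of_surjective
        (fun γ : PLift (IsMax s) × (v ⟶ b.1) => InsArrow.exit γ.1.down γ.2) fun (α : InsArrow Q v _ _ _) => ?_
      cases α with
      | exit hs γ => exact ⟨⟨⟨hs⟩, γ⟩, rfl⟩
    | new t =>
      refine Finite.of_surjective (fun h : PLift (s ⋖ t) => InsArrow.cover h.down) fun (α : InsArrow Q v _ _ _) => ?_
      cases α with
      | cover h => exact ⟨⟨h⟩, rfl⟩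

/-- The last arrow can be read off from its target and the collapsed path because a chain has a
single minimal and a single maximal element and each element covers at most one other. This is the
inductive step of `projPath_injective`; the heterogeneous equalities are needed since the sources of
`α` and `β` are not known to agree beforehand. -/
theorem eq_of_cons_proj_eq {x b c y : InsVertex Q v (Fin (k + 1))}
    (p : Quiver.Path (projVertex x) (projVertex b)) (q : Quiver.Path (projVertex x) (projVertex c))
    (α : InsArrow Q v (Fin (k + 1)) b y) (β : InsArrow Q v (Fin (k + 1)) c y)
    (h : p.comp (projArrow α) = q.comp (projArrow β)) : b = c ∧ HEq α β ∧ HEq p q := by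
  cases α with
  | @arrow a _ γ =>
    cases β with
    | @arrow a' _ γ' =>
      have h' : Quiver.Path.cons (b := a.1) p γ = Quiver.Path.cons (b := a'.1) q γ' := h
      obtain rfl : a = a' := Subtype.ext (Quiver.Path.obj_eq_of_cons_eq_cons h')
      obtain rfl := eq_of_heq (Quiver.Path.hom_heq_of_cons_eq_cons h')
      exact ⟨rfl, HEq.rfl, Quiver.Path.heq_of_cons_eq_cons h'⟩
    | exit hx β =>
      have h' : Quiver.Path.cons (b := a.1) p γ = Quiver.Path.cons (b := v) q β := h
      exact absurd (Quiver.Path.obj_eq_of_cons_eq_cons h') a.2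
  | @cover s t hs =>
    cases β with
    | enter _ ht => exact absurd hs.lt ht.not_lt
    | @cover s' _ hs' =>
      obtain rfl : s = s' := hs.unique_left hs'
      exact ⟨rfl, HEq.rfl, heq_of_eq h⟩
  | @enter a γ t ht =>
    cases β with
    | @enter a' γ' _ ht' =>
      have h' : Quiver.Path.cons (b := a.1) p γ = Quiver.Path.cons (b := a'.1) q γ' := h
      obtain rfl : a = a' := Subtype.ext (Quiver.Path.obj_eq_of_cons_eq_cons h')
      obtain rfl := eq_of_heq (Quiver.Path.hom_heq_of_cons_eq_cons h')
      exact ⟨rfl, HEq.rfl, Quiver.Path.heq_of_cons_eq_cons h'⟩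
    | cover hs => exact absurd hs.lt ht.not_lt
  | @exit s hs b γ =>
    cases β with
    | @arrow a' _ γ' =>
      have h' : Quiver.Path.cons (b := v) p γ = Quiver.Path.cons (b := a'.1) q γ' := h
      exact absurd (Quiver.Path.obj_eq_of_cons_eq_cons h').symm a'.2
    | @exit s' hs' _ γ' =>
      have h' : Quiver.Path.cons (b := v) p γ = Quiver.Path.cons (b := v) q γ' := h
      obtain rfl : s = s' := (isMax_fin_iff.1 hs).trans (isMax_fin_iff.1 hs').symm
      obtain rfl := eq_of_heq (Quiver.Path.hom_heq_of_cons_eq_cons h')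
      exact ⟨rfl, HEq.rfl, Quiver.Path.heq_of_cons_eq_cons h'⟩

/-- Decompose the path at `v` and insert the appropriate segment of the chain. Two chain elements
both collapse to `v`, and the trivial path there lifts only in increasing direction; this is the
role of `hxy`. -/
theorem exists_projPath_eq (hQ : IsAcyclic Q) {x y : InsVertex Q v (Fin (k + 1))}
    (hxy : ∀ s t, x = .new s → y = .new t → s ≤ t)
    (p : Quiver.Path (projVertex x) (projVertex y)) : ∃ q : Quiver.Path x y, projPath q = p := by
  obtain ⟨l⟩ := nonempty_chainPath (Fin.zero_le (Fin.last k))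
  let q₀ : MaximalPath (Fin (k + 1)) := ⟨_, _, isMin_fin_iff.2 rfl, isMax_fin_iff.2 rfl, l⟩
  induction x using InsVertex.old_or_new with
  | old a =>
    induction y using InsVertex.old_or_new with
    | old b =>
      obtain ⟨c, rfl⟩ := exists_pathBetween (a := a) (b := b) hQ p
      exact ⟨c.insert q₀, projPath_insert_pathBetween q₀ c⟩
    | new t =>
      obtain ⟨c, rfl⟩ := exists_pathTo (a := a) hQ p
      obtain ⟨l⟩ := nonempty_chainPath (Fin.zero_le t)
      refine ⟨(c.insert (isMin_fin_iff.2 rfl)).comp (pathNew v l), ?_⟩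
      rw [projPath_comp, projPath_insert_pathTo, projPath_pathNew]
      rfl
  | new s =>
    induction y using InsVertex.old_or_new with
    | old b =>
      obtain ⟨c, rfl⟩ := exists_pathFrom (b := b) hQ p
      obtain ⟨l⟩ := nonempty_chainPath (Fin.le_last s)
      refine ⟨(pathNew v l).comp (c.insert (isMax_fin_iff.2 rfl)), ?_⟩
      rw [projPath_comp, projPath_insert_pathFrom, projPath_pathNew]
      exact Quiver.Path.nil_comp _
    | new t =>
      obtain ⟨l⟩ := nonempty_chainPath (hxy s t rfl rfl)
      exact ⟨pathNew v l, (projPath_pathNew l).trans (hQ v p).symm⟩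

variable [Fintype Q]

/-- The lexicographic rank of a vertex after inserting a chain. -/
noncomputable def insRank : InsVertex Q v (Fin (k + 1)) → ℤ ×ₗ ℕ :=
  Sum.elim (fun a => toLex (pathRank a.1, 0)) fun s => toLex (pathRank v, s.1)

/-- A cover stays over `v` and raises the position in the chain. Every other arrow comes from an
arrow of `Q` and raises the first coordinate. -/
theorem insRank_lt (hQ : IsAcyclic Q) {x y : InsVertex Q v (Fin (k + 1))}
    (α : InsArrow Q v (Fin (k + 1)) x y) : insRank x < insRank y := by
  cases α with
  | arrow γ =>
    exact Prod.Lex.toLex_lt_toLex.2 (Or.inl (hQ.pathRank_lt γ.toPath (hQ.ne_of_arrow γ)))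
  | cover h => exact Prod.Lex.toLex_lt_toLex.2 (Or.inr ⟨rfl, Fin.lt_def.1 h.lt⟩)
  | enter α hx =>
    exact Prod.Lex.toLex_lt_toLex.2 (Or.inl (hQ.pathRank_lt α.toPath (hQ.ne_of_arrow α)))
  | exit hx β =>
    exact Prod.Lex.toLex_lt_toLex.2 (Or.inl (hQ.pathRank_lt β.toPath (hQ.ne_of_arrow β)))

theorem insRank_le (hQ : IsAcyclic Q) {x y : InsVertex Q v (Fin (k + 1))} (p : Quiver.Path x y) :
    insRank x ≤ insRank y := by
  induction p with
  | nil => exact le_rfl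
  | cons p α ih => exact ih.trans (insRank_lt hQ α).le

theorem isAcyclic_insVertex (hQ : IsAcyclic Q) : IsAcyclic (InsVertex Q v (Fin (k + 1))) := by
  intro x p
  cases p with
  | nil => rfl
  | cons p α => exact absurd ((insRank_le hQ p).trans_lt (insRank_lt hQ α)) (lt_irrefl _)

theorem le_of_path (hQ : IsAcyclic Q) {s t : Fin (k + 1)}
    (p : Quiver.Path (InsVertex.new s : InsVertex Q v (Fin (k + 1))) (.new t)) : s ≤ t := by
  have h := insRank_le hQ p
  rcases Prod.Lex.toLex_le_toLex.1 h with h | h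
  · exact absurd h (lt_irrefl _)
  · exact Fin.le_def.2 h.2

theorem projPath_injective (hQ : IsAcyclic Q) {x y : InsVertex Q v (Fin (k + 1))} :
    Function.Injective (projPath : Quiver.Path x y → _) := by
  intro p
  induction p with
  | nil => exact fun q _ => (isAcyclic_insVertex hQ _ q).symm
  | cons p α ih =>
    intro q hpq
    cases q with
    | nil => exact isAcyclic_insVertex hQ _ _
    | cons q β =>
      obtain ⟨rfl, hαβ, hpq'⟩ := eq_of_cons_proj_eq _ _ α β hpq
      rw [eq_of_heq hαβ, ih (eq_of_heq hpq')]

end Chain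

/-! ### The ideal of an insertion collapses into the original ideal -/

section ProjIdeal

variable {K : Type*} [Field K] {Q : Type*} [Quiver Q] {v : Q} {S : Type*} [PartialOrder S]

variable (K) in
/-- The linear extension of the projection of paths. -/
noncomputable def projMap (x y : InsVertex Q v S) :
    (Quiver.Path x y →₀ K) →ₗ[K] (Quiver.Path (projVertex x) (projVertex y) →₀ K) :=
  Finsupp.lmapDomain K K projPath

theorem projMap_single {x y : InsVertex Q v S} (p : Quiver.Path x y) (k : K) :
    projMap K x y (Finsupp.single p k) = Finsupp.single (projPath p) k :=
  Finsupp.mapDomain_single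

theorem projMap_mapDomain {ι : Type*} {x y : InsVertex Q v S} {f : ι → Quiver.Path x y}
    {g : ι → Quiver.Path (projVertex x) (projVertex y)} (h : ∀ i, projPath (f i) = g i)
    (c : ι →₀ K) : projMap K x y (c.mapDomain f) = c.mapDomain g := by
  rw [← funext h]
  exact Finsupp.mapDomain_comp.symm

/-- Different elements of the poset collapse to the same vertex, so collapsing need not respect
vanishing products and is in general no algebra homomorphism. It is multiplicative on composable
components, which is why `projIdeal` is defined by components. -/
theorem projMap_concat {x y z : InsVertex Q v S} (f : Quiver.Path x y →₀ K)
    (g : Quiver.Path y z →₀ K) : projMap K x z (PathAlgebra.concat f g) =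
      PathAlgebra.concat (projMap K x y f) (projMap K y z g) := by
  induction f using Finsupp.induction_linear with
  | zero => rw [PathAlgebra.zero_concat, map_zero, map_zero, PathAlgebra.zero_concat]
  | add f f' h h' =>
    rw [PathAlgebra.add_concat, map_add, h, h', map_add, PathAlgebra.add_concat]
  | single p k =>
    induction g using Finsupp.induction_linear with
    | zero => rw [PathAlgebra.concat_zero, map_zero, map_zero, PathAlgebra.concat_zero]
    | add g g' h h' =>
      rw [PathAlgebra.concat_add, map_add, h, h', map_add, PathAlgebra.concat_add]
    | single q l =>
      rw [PathAlgebra.concat_single, projMap_single, projMap_single, projMap_single,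
        PathAlgebra.concat_single, projPath_comp]

variable [Fintype Q] [Fintype S]

/-- The ideal of all elements whose components project to elements of `I`. -/
noncomputable def projIdeal (I : TwoSidedIdeal (PathAlgebra K Q)) (v : Q) (S : Type*)
    [PartialOrder S] [Fintype S] : TwoSidedIdeal (PathAlgebra K (InsVertex Q v S)) :=
  TwoSidedIdeal.mk' {z | ∀ x y, PathAlgebra.of (projMap K x y (z x y)) ∈ I}
    (fun x y => by
      rw [PathAlgebra.zero_apply, map_zero, PathAlgebra.of_zero]
      exact I.zero_mem)
    (fun {z w} hz hw x y => by
      rw [PathAlgebra.add_apply, map_add, PathAlgebra.of_add]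
      exact I.add_mem (hz x y) (hw x y))
    (fun {z} hz x y => by
      change PathAlgebra.of (projMap K x y (-(z x y))) ∈ I
      rw [← PathAlgebra.ofₗ_apply, map_neg, map_neg]
      exact I.neg_mem (hz x y))
    (fun {w z} hz x y => by
      rw [PathAlgebra.mul_apply, ← PathAlgebra.ofₗ_apply, map_sum, map_sum]
      refine I.finsetSum_mem _ _ fun b _ => ?_
      rw [projMap_concat, PathAlgebra.ofₗ_apply, ← PathAlgebra.of_mul_of]
      exact I.mul_mem_left _ _ (hz b y))
    (fun {z w} hz x y => by
      rw [PathAlgebra.mul_apply, ← PathAlgebra.ofₗ_apply, map_sum, map_sum]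
      refine I.finsetSum_mem _ _ fun b _ => ?_
      rw [projMap_concat, PathAlgebra.ofₗ_apply, ← PathAlgebra.of_mul_of]
      exact I.mul_mem_right _ _ (hz x b))

theorem mem_projIdeal {I : TwoSidedIdeal (PathAlgebra K Q)}
    {z : PathAlgebra K (InsVertex Q v S)} :
    z ∈ projIdeal I v S ↔ ∀ x y, PathAlgebra.of (projMap K x y (z x y)) ∈ I :=
  TwoSidedIdeal.mem_mk' ..

theorem of_mem_projIdeal {I : TwoSidedIdeal (PathAlgebra K Q)} {x y : InsVertex Q v S}
    (f : Quiver.Path x y →₀ K) :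
    PathAlgebra.of f ∈ projIdeal I v S ↔ PathAlgebra.of (projMap K x y f) ∈ I := by
  rw [mem_projIdeal]
  refine ⟨fun h => by simpa only [PathAlgebra.of_apply_self] using h x y, fun h x' y' => ?_⟩
  by_cases hx : x' = x
  · subst hx
    by_cases hy : y' = y
    · subst hy
      rwa [PathAlgebra.of_apply_self]
    · rw [PathAlgebra.of_apply_ne_right _ hy, map_zero, PathAlgebra.of_zero]
      exact I.zero_mem
  · rw [PathAlgebra.of_apply_ne_left _ hx, map_zero, PathAlgebra.of_zero]
    exact I.zero_mem

theorem ofPath_sub_mem_projIdeal (I : TwoSidedIdeal (PathAlgebra K Q)) {x y : InsVertex Q v S}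
    {p q : Quiver.Path x y} (h : projPath p = projPath q) :
    PathAlgebra.ofPath p - PathAlgebra.ofPath q ∈ projIdeal I v S := by
  rw [PathAlgebra.ofPath, PathAlgebra.ofPath, ← PathAlgebra.ofₗ_apply, ← PathAlgebra.ofₗ_apply,
    ← map_sub, PathAlgebra.ofₗ_apply, of_mem_projIdeal, map_sub, projMap_single, projMap_single,
    h, sub_self, PathAlgebra.of_zero]
  exact I.zero_mem

/-- The ideal defining an insertion. -/
noncomputable def insIdeal (I : TwoSidedIdeal (PathAlgebra K Q)) (v : Q) (S : Type*)
    [PartialOrder S] [Fintype S] : TwoSidedIdeal (PathAlgebra K (InsVertex Q v S)) :=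
  TwoSidedIdeal.span {x | InsRelation I v S x}

/-- A commutativity relation collapses to zero, since both of its paths have the same image. The
other generators collapse to the elements of `I` they were made from. -/
theorem insIdeal_le_projIdeal (I : TwoSidedIdeal (PathAlgebra K Q)) (v : Q) (S : Type*)
    [PartialOrder S] [Fintype S] : insIdeal I v S ≤ projIdeal I v S := by
  rw [insIdeal, TwoSidedIdeal.span_le]
  intro z hz
  cases hz with
  | ending hx c hc =>
    refine (of_mem_projIdeal _).2 ?_
    rwa [projMap_mapDomain (projPath_insert_pathTo hx)]
  | starting hx c hc =>
    refine (of_mem_projIdeal _).2 ?_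
    rwa [projMap_mapDomain (projPath_insert_pathFrom hx)]
  | comm q' q'' =>
    exact ofPath_sub_mem_projIdeal I ((projPath_pathNew q').trans (projPath_pathNew q'').symm)
  | commEnter α hx' hx'' q' q'' =>
    refine ofPath_sub_mem_projIdeal I ?_
    rw [projPath_comp, projPath_comp, projPath_pathNew, projPath_pathNew]
    rfl
  | commExit β hy' hy'' q' q'' =>
    refine ofPath_sub_mem_projIdeal I ?_
    rw [projPath_cons, projPath_cons, projPath_pathNew, projPath_pathNew]
    rfl
  | commThrough α β q' q'' =>
    refine ofPath_sub_mem_projIdeal I ?_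
    rw [projPath_cons, projPath_cons, projPath_comp, projPath_comp, projPath_pathNew,
      projPath_pathNew]
    rfl
  | passing q c hc =>
    refine (of_mem_projIdeal _).2 ?_
    rwa [projMap_mapDomain (projPath_insert_pathBetween q)]

end ProjIdeal

/-! ### The ideal of a chain insertion -/

section ChainIdeal

variable {K : Type*} [Field K] {Q : Type*} [Quiver Q] [Fintype Q] {v : Q} {k : ℕ}

theorem projMap_injective (hQ : IsAcyclic Q) (x y : InsVertex Q v (Fin (k + 1))) :
    Function.Injective (projMap K x y) :=
  Finsupp.mapDomain_injective (projPath_injective hQ)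

/-- Decompose the paths of the collapsed combination at `v`, lift them to a generator of type
`ending`, `starting` or `passing`, and multiply by a segment of the chain if an end lies inside it.
The result has the same collapse as `f`, hence equals `f` by injectivity. -/
theorem of_mem_insIdeal_of_proj_mem (hQ : IsAcyclic Q) {I : TwoSidedIdeal (PathAlgebra K Q)}
    (hI : IsRelationIdeal I) {x y : InsVertex Q v (Fin (k + 1))} (f : Quiver.Path x y →₀ K)
    (hf : PathAlgebra.of (projMap K x y f) ∈ I) :
    PathAlgebra.of f ∈ insIdeal I v (Fin (k + 1)) := by
  have h0 : IsMin (0 : Fin (k + 1)) := isMin_fin_iff.2 rfl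
  have hlast : IsMax (Fin.last k) := isMax_fin_iff.2 rfl
  induction x using InsVertex.old_or_new with
  | old a =>
    induction y using InsVertex.old_or_new with
    | old b =>
      obtain ⟨l⟩ := nonempty_chainPath (Fin.zero_le (Fin.last k))
      let q : MaximalPath (Fin (k + 1)) := ⟨_, _, h0, hlast, l⟩
      obtain ⟨c, hc⟩ := Finsupp.mapDomain_surjective
        (fun p => exists_pathBetween (a := a) (b := b) hQ p) (projMap K _ _ f)
      have hcf : c.mapDomain (PathBetween.insert q) = f := by
        apply projMap_injective hQ
        exact (projMap_mapDomain (projPath_insert_pathBetween q) c).trans hc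
      rw [← hcf]
      refine TwoSidedIdeal.subset_span (InsRelation.passing q c ?_)
      rw [hc]
      exact hf
    | new t =>
      obtain ⟨l⟩ := nonempty_chainPath (Fin.zero_le t)
      obtain ⟨c, hc⟩ := Finsupp.mapDomain_surjective
        (fun p => exists_pathTo (a := a) hQ p) (projMap K _ _ f)
      have hcf : PathAlgebra.concat (c.mapDomain (PathTo.insert h0))
          (Finsupp.single (pathNew v l) 1) = f := by
        apply projMap_injective hQ
        rw [projMap_concat, projMap_mapDomain (projPath_insert_pathTo h0), ← hc, projMap_single,
          projPath_pathNew]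
        exact PathAlgebra.concat_nil _
      rw [← hcf, ← PathAlgebra.of_mul_of]
      refine TwoSidedIdeal.mul_mem_right _ _ _
        (TwoSidedIdeal.subset_span (InsRelation.ending h0 c ?_))
      rw [hc]
      exact hf
  | new s =>
    induction y using InsVertex.old_or_new with
    | old b =>
      obtain ⟨l⟩ := nonempty_chainPath (Fin.le_last s)
      obtain ⟨c, hc⟩ := Finsupp.mapDomain_surjective
        (fun p => exists_pathFrom (b := b) hQ p) (projMap K _ _ f)
      have hcf : PathAlgebra.concat (Finsupp.single (pathNew v l) 1)
          (c.mapDomain (PathFrom.insert hlast)) = f := by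
        apply projMap_injective hQ
        rw [projMap_concat, projMap_mapDomain (projPath_insert_pathFrom hlast), ← hc,
          projMap_single, projPath_pathNew]
        exact PathAlgebra.nil_concat _
      rw [← hcf, ← PathAlgebra.of_mul_of]
      refine TwoSidedIdeal.mul_mem_left _ _ _
        (TwoSidedIdeal.subset_span (InsRelation.starting hlast c ?_))
      rw [hc]
      exact hf
    | new t =>
      -- Between two elements of the chain the collapse is a multiple of the trivial path at `v`,
      -- and a nonzero multiple is too short to lie in `I`.
      have hzero : projMap K (InsVertex.new s : InsVertex Q v (Fin (k + 1))) (.new t) f = 0 := by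
        by_contra hne
        obtain ⟨p, hp⟩ := Finsupp.support_nonempty_iff.2 hne
        have hlen := hI.length hf p hp
        have hnil : p.length = 0 := congrArg Quiver.Path.length (hQ v p)
        omega
      rw [projMap_injective hQ _ _ (hzero.trans (map_zero _).symm), PathAlgebra.of_zero]
      exact TwoSidedIdeal.zero_mem _

theorem of_mem_insIdeal_iff (hQ : IsAcyclic Q) {I : TwoSidedIdeal (PathAlgebra K Q)}
    (hI : IsRelationIdeal I) {x y : InsVertex Q v (Fin (k + 1))} (f : Quiver.Path x y →₀ K) :
    PathAlgebra.of f ∈ insIdeal I v (Fin (k + 1)) ↔ PathAlgebra.of (projMap K x y f) ∈ I :=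
  ⟨fun h => (of_mem_projIdeal f).1 (insIdeal_le_projIdeal I v _ h),
    of_mem_insIdeal_of_proj_mem hQ hI f⟩

theorem isRelationIdeal_insIdeal (hQ : IsAcyclic Q) {I : TwoSidedIdeal (PathAlgebra K Q)}
    (hI : IsRelationIdeal I) : IsRelationIdeal (insIdeal I v (Fin (k + 1))) := by
  refine isRelationIdeal_of_length fun x y f hf p hp => ?_
  refine (hI.length ((of_mem_insIdeal_iff hQ hI f).1 hf) (projPath p) ?_).trans
    (length_projPath_le p)
  rw [Finsupp.mem_support_iff] at hp ⊢
  rwa [projMap, Finsupp.lmapDomain_apply, Finsupp.mapDomain_apply (projPath_injective hQ)]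

/-- Collapsing is a bijection on the paths from `x` to `y` and matches the two ideals there. The
excluded pairs of chain elements have zero component by `finrank_peirce_insIdeal_of_lt`. -/
theorem finrank_peirce_insIdeal (hQ : IsAcyclic Q) {I : TwoSidedIdeal (PathAlgebra K Q)}
    (hI : IsRelationIdeal I) {x y : InsVertex Q v (Fin (k + 1))}
    (hxy : ∀ s t, x = .new s → y = .new t → s ≤ t) :
    Module.finrank K (peirce K (idem (insIdeal I v (Fin (k + 1))) x) (idem (insIdeal I v _) y)) =
      Module.finrank K (peirce K (idem I (projVertex x)) (idem I (projVertex y))) := by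
  rw [peirce_idem, peirce_idem]
  refine finrank_range_eq_of_ker_eq _ _ (Finsupp.domLCongr (R := K) (M := K) (Equiv.ofBijective projPath
    ⟨projPath_injective hQ, exists_projPath_eq hQ hxy⟩)) fun f => ?_
  rw [pathHom_apply, pathHom_apply, quotMk_eq_zero_iff, quotMk_eq_zero_iff,
    of_mem_insIdeal_iff hQ hI]
  have : projMap K x y f = Finsupp.domLCongr (R := K) (M := K) (Equiv.ofBijective projPath
    ⟨projPath_injective hQ, exists_projPath_eq hQ hxy⟩) f := by
    rw [Finsupp.domLCongr_apply, Finsupp.domCongr_apply, Finsupp.equivMapDomain_eq_mapDomain]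
    rfl
  rw [this]

theorem finrank_peirce_insIdeal_of_lt (hQ : IsAcyclic Q) (I : TwoSidedIdeal (PathAlgebra K Q))
    {s t : Fin (k + 1)} (hst : t < s) :
    Module.finrank K (peirce K (idem (insIdeal I v (Fin (k + 1))) (.new s))
      (idem (insIdeal I v _) (.new t))) = 0 := by
  rw [peirce_idem]
  have : IsEmpty (Quiver.Path (InsVertex.new s : InsVertex Q v (Fin (k + 1))) (.new t)) :=
    ⟨fun p => not_le.2 hst (le_of_path hQ p)⟩
  have h0 : pathHom (insIdeal I v (Fin (k + 1))) (.new s) (.new t) = 0 :=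
    LinearMap.ext fun f => by rw [Subsingleton.elim f 0, map_zero, map_zero]
  rw [h0, LinearMap.range_zero, finrank_bot]

/-- Inserting the chain with one element does not change the algebra. -/
theorem nonempty_insertion_one_equiv (hQ : IsAcyclic Q) {I : TwoSidedIdeal (PathAlgebra K Q)}
    (hI : IsRelationIdeal I) : Nonempty (Insertion I v (Fin 1) ≃ₐ[K] QuotAlg I) := by
  classical
  -- With a single element in the chain, distinct vertices remain distinct, so here collapsing does
  -- give an algebra homomorphism.
  have hinj : Function.Injective (projVertex : InsVertex Q v (Fin 1) → Q) := by
    intro x y h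
    induction x using InsVertex.old_or_new with
    | old a =>
      induction y using InsVertex.old_or_new with
      | old b => exact congrArg InsVertex.old (Subtype.ext h)
      | new t => exact absurd h a.2
    | new s =>
      induction y using InsVertex.old_or_new with
      | old b => exact absurd h.symm b.2
      | new t => exact congrArg InsVertex.new (Subsingleton.elim s t)
  have hsurj : Function.Surjective (projVertex : InsVertex Q v (Fin 1) → Q) := by
    intro a
    by_cases ha : a = v
    · exact ⟨.new 0, ha.symm⟩
    · exact ⟨.old ⟨a, ha⟩, rfl⟩
  let F : PathAlgebra K (InsVertex Q v (Fin 1)) →ₐ[K] QuotAlg I :=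
    PathAlgebra.lift (fun x y p => quotMk I (PathAlgebra.ofPath (projPath p)))
      (by
        rw [← map_one (quotMk I), PathAlgebra.one_eq_sum, map_sum]
        exact (Equiv.ofBijective projVertex ⟨hinj, hsurj⟩).sum_comp
          fun a => quotMk I (PathAlgebra.vertexIdem a))
      (fun x y z p q => by rw [projPath_comp, ← PathAlgebra.ofPath_mul_ofPath, map_mul])
      (fun x y y' z p q hy => by
        rw [← map_mul, PathAlgebra.ofPath_mul_ofPath_ne (hinj.ne hy), map_zero])
  have hF : ∀ {x y : InsVertex Q v (Fin 1)} (f : Quiver.Path x y →₀ K),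
      F (PathAlgebra.of f) = quotMk I (PathAlgebra.of (projMap K x y f)) := by
    intro x y f
    have h1 : F.toLinearMap ∘ₗ PathAlgebra.ofₗ K x y =
        (quotMk I).toLinearMap ∘ₗ PathAlgebra.ofₗ K _ _ ∘ₗ projMap K x y := by
      refine Finsupp.lhom_ext' fun p => LinearMap.ext_ring ?_
      change F (PathAlgebra.ofPath p) =
        quotMk I (PathAlgebra.of (projMap K x y (Finsupp.single p 1)))
      rw [projMap_single]
      exact PathAlgebra.linearLift_ofPath _ p
    exact LinearMap.congr_fun h1 f
  refine nonempty_quotAlg_equiv (insIdeal I v (Fin 1)) F (fun y => ?_) fun z => ?_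
  · obtain ⟨z, rfl⟩ := quotMk_surjective I y
    rw [PathAlgebra.eq_sum_of z, map_sum]
    change _ ∈ F.range
    refine Subalgebra.sum_mem _ fun a _ => ?_
    rw [map_sum]
    refine Subalgebra.sum_mem _ fun b _ => ?_
    obtain ⟨x, rfl⟩ := hsurj a
    obtain ⟨y, rfl⟩ := hsurj b
    obtain ⟨f, hf⟩ := Finsupp.mapDomain_surjective
      (exists_projPath_eq hQ (x := x) (y := y) fun s t _ _ => (Subsingleton.elim (α := Fin 1) s t).le)
      (z (projVertex x) (projVertex y))
    refine ⟨PathAlgebra.of f, ?_⟩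
    rw [← hf]
    exact hF f
  · rw [PathAlgebra.mem_iff_of_mem]
    constructor
    · intro hz x y
      rw [of_mem_insIdeal_iff hQ hI, ← quotMk_eq_zero_iff, ← hF,
        ← PathAlgebra.vertexIdem_mul_mul_vertexIdem, map_mul, map_mul, hz, mul_zero, zero_mul]
    · intro hz
      rw [PathAlgebra.eq_sum_of z, map_sum]
      refine Finset.sum_eq_zero fun x _ => ?_
      rw [map_sum]
      refine Finset.sum_eq_zero fun y _ => ?_
      rw [hF, quotMk_eq_zero_iff, ← of_mem_insIdeal_iff hQ hI]
      exact hz x y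

end ChainIdeal

/-! ### Determinants and the three-term recurrence -/

section Determinants

open Matrix

theorem det_fromBlocks_swap {R : Type*} [CommRing R] {m : Type*} [Fintype m] [DecidableEq m]
    (H : Matrix m m R) (c : Matrix m (Fin 1) R) (r : Matrix (Fin 1) m R)
    (d : Matrix (Fin 1) (Fin 1) R) (x : R) :
    (fromBlocks (fromBlocks H c r d) (fromRows (0 : Matrix m (Fin 1) R) !![-1])
      (fromCols (0 : Matrix (Fin 1) m R) !![-x]) (0 : Matrix (Fin 1) (Fin 1) R)).det =
      -(x * H.det) := by
  -- Exchanging the last two columns makes the matrix block triangular, with `-1` and `-x` split off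
  -- from `H`; the transposition accounts for the sign.
  have h1 := det_permute' (Equiv.swap (Sum.inl (Sum.inr 0)) (Sum.inr 0))
    (fromBlocks (fromBlocks H c r d) (fromRows (0 : Matrix m (Fin 1) R) !![-1])
      (fromCols (0 : Matrix (Fin 1) m R) !![-x]) (0 : Matrix (Fin 1) (Fin 1) R))
  have h2 : (fromBlocks (fromBlocks H c r d) (fromRows (0 : Matrix m (Fin 1) R) !![-1])
      (fromCols (0 : Matrix (Fin 1) m R) !![-x]) (0 : Matrix (Fin 1) (Fin 1) R)).submatrix id
        (Equiv.swap (Sum.inl (Sum.inr 0)) (Sum.inr 0)) =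
      fromBlocks (fromBlocks H 0 r !![-1]) (fromRows c d) 0 !![-x] := by
    ext i j
    rcases j with (j | j) | j
    · rw [submatrix_apply, Equiv.swap_apply_of_ne_of_ne (by simp) (by simp)]
      rcases i with (i | i) | i <;> simp
    · obtain rfl := Subsingleton.elim j 0
      rw [submatrix_apply, Equiv.swap_apply_left]
      rcases i with (i | i) | i <;> simp
    · obtain rfl := Subsingleton.elim j 0
      rw [submatrix_apply, Equiv.swap_apply_right]
      rcases i with (i | i) | i
      · simp
      · obtain rfl := Subsingleton.elim i 0
        simp
      · obtain rfl := Subsingleton.elim i 0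
        simp
  rw [h2, Equiv.Perm.sign_swap (by simp), det_fromBlocks_zero₂₁, det_fromBlocks_zero₁₂,
    det_fin_one_of, det_fin_one_of] at h1
  simp only [Units.val_neg, Units.val_one, Int.cast_neg, Int.cast_one] at h1
  linear_combination h1

theorem det_fromBlocks_corner {R : Type*} [CommRing R] {m : Type*} [Fintype m] [DecidableEq m]
    (M : Matrix m m R) (c : Matrix m (Fin 1) R) (r : Matrix (Fin 1) m R) (x : R) :
    (fromBlocks M c r !![x]).det = x * M.det + (fromBlocks M c r !![0]).det := by
  have hrow : fromBlocks M c r !![x] = updateRow (fromBlocks M c r !![0]) (Sum.inr 0)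
      ((Sum.elim 0 (fun _ => x) : m ⊕ Fin 1 → R) + (Sum.elim (r 0) 0 : m ⊕ Fin 1 → R)) := by
    ext i j
    rcases i with i | i
    · rw [updateRow_ne (by simp)]
      rcases j with j | j <;> simp
    · obtain rfl := Subsingleton.elim i 0
      rw [updateRow_self]
      rcases j with j | j <;> simp
  have hrow1 : updateRow (fromBlocks M c r !![0]) (Sum.inr 0)
      (Sum.elim 0 (fun _ => x) : m ⊕ Fin 1 → R) = fromBlocks M c 0 !![x] := by
    ext i j
    rcases i with i | i
    · rw [updateRow_ne (by simp)]
      rcases j with j | j <;> simp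
    · obtain rfl := Subsingleton.elim i 0
      rw [updateRow_self]
      rcases j with j | j <;> simp
  have hrow2 : updateRow (fromBlocks M c r !![0]) (Sum.inr 0)
      (Sum.elim (r 0) 0 : m ⊕ Fin 1 → R) = fromBlocks M c r !![0] := by
    ext i j
    rcases i with i | i
    · rw [updateRow_ne (by simp)]
    · obtain rfl := Subsingleton.elim i 0
      rw [updateRow_self]
      rcases j with j | j <;> simp
  rw [hrow, det_updateRow_add, hrow1, hrow2, det_fromBlocks_zero₂₁, det_fin_one_of, mul_comm x]

/-- The determinant of a matrix whose last two rows and columns almost agree. -/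
theorem det_fromBlocks_repeat {R : Type*} [CommRing R] {m : Type*} [Fintype m] [DecidableEq m]
    (H : Matrix m m R) (c : Matrix m (Fin 1) R) (r : Matrix (Fin 1) m R) (x : R) :
    (fromBlocks (fromBlocks H c r !![x + 1]) (fromRows c !![x])
      (fromCols r !![1]) !![x + 1]).det =
      (x + 1) * (fromBlocks H c r !![x + 1]).det - x * H.det := by
  -- These unimodular factors subtract the last but one row from the last row and then do the same
  -- for columns. The border is cleared down to `-x` and `-1`, and the corner becomes `1 + x` again.
  have hL : (fromBlocks 1 0 (fromCols 0 !![-1]) 1 : Matrix ((m ⊕ Fin 1) ⊕ Fin 1) _ R).det = 1 := by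
    rw [det_fromBlocks_zero₁₂, det_one, det_one, one_mul]
  have hU : (fromBlocks 1 (fromRows 0 !![-1]) 0 1 : Matrix ((m ⊕ Fin 1) ⊕ Fin 1) _ R).det = 1 := by
    rw [det_fromBlocks_zero₂₁, det_one, det_one, one_mul]
  have hmul : (fromBlocks 1 0 (fromCols 0 !![-1]) 1 : Matrix ((m ⊕ Fin 1) ⊕ Fin 1) _ R) *
      (fromBlocks (fromBlocks H c r !![x + 1]) (fromRows c !![x]) (fromCols r !![1]) !![x + 1]) *
        fromBlocks 1 (fromRows 0 !![-1]) 0 1 =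
      fromBlocks (fromBlocks H c r !![x + 1]) (fromRows 0 !![-1]) (fromCols 0 !![-x])
        !![x + 1] := by
    have hneg : ∀ (y : R) (r : Matrix (Fin 1) m R), !![y] * r = y • r := fun y r => by
      ext i j
      simp [Matrix.mul_apply, Subsingleton.elim i 0]
    have hneg' : ∀ (y : R) (c : Matrix m (Fin 1) R), c * !![y] = y • c := fun y c => by
      ext i j
      simp [Matrix.mul_apply, Subsingleton.elim j 0, mul_comm]
    have hneg1 : ∀ y z : R, (!![y] : Matrix (Fin 1) (Fin 1) R) * !![z] = !![y * z] := fun y z => by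
      ext i j
      simp [Matrix.mul_apply]
    have e1 : fromCols (0 : Matrix (Fin 1) m R) !![-1] * fromBlocks H c r !![x + 1] + fromCols r !![1] =
        fromCols 0 !![-x] := by
      rw [fromCols_mul_fromBlocks, Matrix.zero_mul, Matrix.zero_mul, hneg, hneg1]
      ext i j
      rcases j with j | j <;> simp
    have e2 : fromBlocks H c r !![x + 1] * fromRows (0 : Matrix m (Fin 1) R) !![-1] +
        fromRows c !![x] =
        fromRows 0 !![-1] := by
      rw [fromBlocks_mul_fromRows, Matrix.mul_zero, Matrix.mul_zero, hneg', hneg1]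
      ext i j
      rcases i with i | i <;> simp
    have e3 : fromCols (0 : Matrix (Fin 1) m R) !![-1] * fromRows c !![x] + !![x + 1] =
        (!![1] : Matrix (Fin 1) (Fin 1) R) := by
      rw [fromCols_mul_fromRows, Matrix.zero_mul, hneg1]
      ext i j
      simp
    have e4 : fromCols (0 : Matrix (Fin 1) m R) !![-x] * fromRows (0 : Matrix m (Fin 1) R) !![-1] + !![1] =
        (!![x + 1] : Matrix (Fin 1) (Fin 1) R) := by
      rw [fromCols_mul_fromRows, Matrix.zero_mul, hneg1]
      ext i j
      simp
    rw [fromBlocks_multiply, fromBlocks_multiply]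
    simp only [Matrix.one_mul, Matrix.zero_mul, add_zero, Matrix.mul_one,
      Matrix.mul_zero, e1, e2, e3, e4]
  have hdet := congrArg det hmul
  rw [det_mul, det_mul, hL, hU, one_mul, mul_one] at hdet
  rw [hdet, det_fromBlocks_corner, show (!![0] : Matrix (Fin 1) (Fin 1) R) = 0 by ext i j; simp,
    det_fromBlocks_swap]
  ring

variable {D : Type*}

/-- The Cartan matrix of an algebra in which a vertex is replaced by a chain: the chain sees the
remaining vertices `D` as the replaced vertex does. -/
def chainMatrix (B : Matrix D D ℤ) (p q : D → ℤ) (k : ℕ) : Matrix (D ⊕ Fin k) (D ⊕ Fin k) ℤ :=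
  fromBlocks B (fun a _ => p a) (fun _ b => q b) (fun s t => if s ≤ t then 1 else 0)

/-- The last element of a chain as a separate summand. -/
def chainSuccEquiv (D : Type*) (k : ℕ) : (D ⊕ Fin k) ⊕ Fin 1 ≃ D ⊕ Fin (k + 1) :=
  (Equiv.sumAssoc D (Fin k) (Fin 1)).trans (Equiv.sumCongr (Equiv.refl D) finSumFinEquiv)

theorem chainMatrix_succ (B : Matrix D D ℤ) (p q : D → ℤ) (k : ℕ) :
    (chainMatrix B p q (k + 1)).submatrix (chainSuccEquiv D k) (chainSuccEquiv D k) =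
      fromBlocks (chainMatrix B p q k) (fromRows (fun a _ => p a) fun _ _ => 1)
        (fromCols (fun _ b => q b) fun _ _ => 0) !![1] := by
  ext i j
  rcases i with (i | i) | i
  · rcases j with (j | j) | j <;> rfl
  · rcases j with (j | j) | j
    · rfl
    · change (if Fin.castAdd 1 i ≤ Fin.castAdd 1 j then (1 : ℤ) else 0) = if i ≤ j then 1 else 0
      rfl
    · change (if Fin.castAdd 1 i ≤ Fin.natAdd k j then (1 : ℤ) else 0) = 1
      exact if_pos (Fin.le_def.2 (by simp))
  · obtain rfl := Subsingleton.elim i 0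
    rcases j with (j | j) | j
    · rfl
    · change (if Fin.natAdd k 0 ≤ Fin.castAdd 1 j then (1 : ℤ) else 0) = 0
      exact if_neg (fun h => by have := Fin.le_def.1 h; simp at this; omega)
    · obtain rfl := Subsingleton.elim j 0
      change (if Fin.natAdd k 0 ≤ Fin.natAdd k 0 then (1 : ℤ) else 0) = 1
      exact if_pos le_rfl

variable [Fintype D] [DecidableEq D]

/-- Transposing `x M + Mᵀ` exchanges the roles of `M` and `Mᵀ`. This makes it irrelevant that the
Cartan matrix is the transpose of the matrix of Peirce dimensions. -/
theorem coxeterDet_transpose (M : Matrix D D ℤ) : coxeterDet M.transpose = coxeterDet M := by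
  unfold coxeterDet
  rw [← det_transpose]
  congr 1

theorem coxeterDet_fromBlocks {m l : Type*} [Fintype m] [DecidableEq m] [Fintype l]
    [DecidableEq l] (M : Matrix m m ℤ) (c : Matrix m l ℤ) (r : Matrix l m ℤ) (d : Matrix l l ℤ) :
    coxeterDet (fromBlocks M c r d) =
      (fromBlocks ((X : ℤ[X]) • M.map (Polynomial.C : ℤ →+* ℤ[X]) +
          (M.map (Polynomial.C : ℤ →+* ℤ[X])).transpose)
        ((X : ℤ[X]) • c.map (Polynomial.C : ℤ →+* ℤ[X]) +
          (r.map (Polynomial.C : ℤ →+* ℤ[X])).transpose)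
        ((X : ℤ[X]) • r.map (Polynomial.C : ℤ →+* ℤ[X]) +
          (c.map (Polynomial.C : ℤ →+* ℤ[X])).transpose)
        ((X : ℤ[X]) • d.map (Polynomial.C : ℤ →+* ℤ[X]) +
          (d.map (Polynomial.C : ℤ →+* ℤ[X])).transpose)).det := by
  unfold coxeterDet
  rw [fromBlocks_map, fromBlocks_transpose, fromBlocks_smul, fromBlocks_add]

/-- The last two elements of the chain have the same relations to `D` and to the earlier elements.
Their own block in `x C + Cᵀ` has diagonal entries `x + 1`, upper entry `x` and lower entry `1`,
which is the pattern of `det_fromBlocks_repeat`. -/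
theorem coxeterDet_chainMatrix (B : Matrix D D ℤ) (p q : D → ℤ) (k : ℕ) :
    coxeterDet (chainMatrix B p q (k + 2)) =
      (X + 1) * coxeterDet (chainMatrix B p q (k + 1)) - X * coxeterDet (chainMatrix B p q k) := by
  have h1 : coxeterDet (chainMatrix B p q (k + 1)) = coxeterDet
      (fromBlocks (chainMatrix B p q k) (fromRows (fun a _ => p a) fun _ _ => 1)
        (fromCols (fun _ b => q b) fun _ _ => 0) !![1]) := by
    rw [← chainMatrix_succ, coxeterDet_reindex]
  have h2 : coxeterDet (chainMatrix B p q (k + 2)) = coxeterDet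
      (fromBlocks (fromBlocks (chainMatrix B p q k) (fromRows (fun a _ => p a) fun _ _ => 1)
          (fromCols (fun _ b => q b) fun _ _ => 0) !![1])
        (fromRows (fromRows (fun a _ => p a) fun _ _ => 1) !![1])
        (fromCols (fromCols (fun _ b => q b) fun _ _ => 0) !![0]) !![1]) := by
    have hc : (fromRows (fun a _ => p a) fun _ _ => 1 :
        Matrix (D ⊕ Fin (k + 1)) (Fin 1) ℤ).submatrix (chainSuccEquiv D k) id =
        fromRows (fromRows (fun a _ => p a) fun _ _ => 1) !![1] := by
      ext i j
      rcases i with (i | i) | i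
      · rfl
      · rfl
      · obtain rfl := Subsingleton.elim i 0
        obtain rfl := Subsingleton.elim j 0
        rfl
    have hr : (fromCols (fun _ b => q b) fun _ _ => 0 :
        Matrix (Fin 1) (D ⊕ Fin (k + 1)) ℤ).submatrix id (chainSuccEquiv D k) =
        fromCols (fromCols (fun _ b => q b) fun _ _ => 0) !![0] := by
      ext i j
      rcases j with (j | j) | j
      · rfl
      · rfl
      · obtain rfl := Subsingleton.elim i 0
        obtain rfl := Subsingleton.elim j 0
        rfl
    rw [← coxeterDet_reindex (chainSuccEquiv D (k + 1)), chainMatrix_succ,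
      ← coxeterDet_reindex ((chainSuccEquiv D k).sumCongr (Equiv.refl (Fin 1))),
      ← chainMatrix_succ B p q k, ← hc, ← hr]
    congr 1
    ext i j
    rcases i with i | i <;> rcases j with j | j <;> rfl
  have h3 := det_fromBlocks_repeat
    ((X : ℤ[X]) • (chainMatrix B p q k).map (Polynomial.C : ℤ →+* ℤ[X]) +
      ((chainMatrix B p q k).map (Polynomial.C : ℤ →+* ℤ[X])).transpose)
    ((X : ℤ[X]) • (fromRows (fun a _ => p a) fun _ _ => 1 :
        Matrix (D ⊕ Fin k) (Fin 1) ℤ).map (Polynomial.C : ℤ →+* ℤ[X]) +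
      ((fromCols (fun _ b => q b) fun _ _ => 0 : Matrix (Fin 1) (D ⊕ Fin k) ℤ).map
        (Polynomial.C : ℤ →+* ℤ[X])).transpose)
    ((X : ℤ[X]) • (fromCols (fun _ b => q b) fun _ _ => 0 :
        Matrix (Fin 1) (D ⊕ Fin k) ℤ).map (Polynomial.C : ℤ →+* ℤ[X]) +
      ((fromRows (fun a _ => p a) fun _ _ => 1 : Matrix (D ⊕ Fin k) (Fin 1) ℤ).map
        (Polynomial.C : ℤ →+* ℤ[X])).transpose) (X : ℤ[X])
  have hd : (X : ℤ[X]) • (!![1] : Matrix (Fin 1) (Fin 1) ℤ).map (Polynomial.C : ℤ →+* ℤ[X]) +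
      ((!![1] : Matrix (Fin 1) (Fin 1) ℤ).map (Polynomial.C : ℤ →+* ℤ[X])).transpose =
      !![X + 1] := by
    ext1 i j
    simp
  rw [h1, h2, coxeterDet_fromBlocks, coxeterDet_fromBlocks, hd]
  refine Eq.trans ?_ h3
  congr 2
  · rw [fromBlocks_map, fromBlocks_transpose, fromBlocks_smul, fromBlocks_add, hd]
  · ext1 i j
    rcases i with i | i <;> simp
  · ext1 i j
    rcases j with j | j <;> simp

/-- The degree is at most the size of the matrix, and the coefficient in that degree is `det M`. -/
theorem natDegree_coxeterDet {M : Matrix D D ℤ} (hM : M.det = 1) :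
    (coxeterDet M).natDegree = Fintype.card D := by
  refine le_antisymm (natDegree_det_X_add_C_le M M.transpose) ?_
  refine le_natDegree_of_ne_zero ?_
  have := coeff_det_X_add_C_card M M.transpose
  rw [hM] at this
  unfold coxeterDet
  rw [← transpose_map, this]
  exact one_ne_zero

end Determinants

/-! ### Degree of the Coxeter polynomial of a directed algebra -/

section Directed

variable {K : Type w} [Field K] {A : Type u} [Ring A] [Algebra K A] {n : Type*} [Fintype n]
  {e : n → A} {r : n → ℤ}

theorem IsDirected.reindex (h : IsDirected K e r) {m : Type*} [Fintype m] (f : m ≃ n) :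
    IsDirected K (fun a => e (f a)) (fun a => r (f a)) where
  idem a := h.idem (f a)
  ortho a b hab := h.ortho (f.injective.ne hab)
  complete := by rw [← h.complete, f.sum_comp e]
  ne_zero a := h.ne_zero (f a)
  scalar a := h.scalar (f a)
  rank_lt a b x hab hx := h.rank_lt (f a) (f b) x (f.injective.ne hab) hx

variable (K) in
/-- The matrix of the dimensions of the components `e a A e b`. -/
noncomputable def dimMatrix (e : n → A) : Matrix n n ℤ :=
  Matrix.of fun a b => (Module.finrank K (peirce K (e a) (e b)) : ℤ)

theorem IsDirected.finrank_peirce_self (h : IsDirected K e r) (a : n) :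
    Module.finrank K (peirce K (e a) (e a)) = 1 := by
  have : peirce K (e a) (e a) = Submodule.span K {e a} := by
    ext x
    rw [mem_peirce, Submodule.mem_span_singleton]
    constructor
    · rintro ⟨y, rfl⟩
      obtain ⟨k, hk⟩ := h.scalar a y
      exact ⟨k, hk.symm⟩
    · rintro ⟨k, rfl⟩
      exact ⟨k • 1, by simp [(h.idem a).eq]⟩
  rw [this, finrank_span_singleton (h.ne_zero a)]

theorem IsDirected.dimMatrix_eq_zero (h : IsDirected K e r) {a b : n} (hab : a ≠ b)
    (hr : r b ≤ r a) : dimMatrix K e a b = 0 := by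
  have : peirce K (e a) (e b) = ⊥ := by
    rw [eq_bot_iff]
    intro x hx
    obtain ⟨y, rfl⟩ := mem_peirce.1 hx
    by_contra h0
    exact not_lt.2 hr (h.rank_lt a b y hab h0)
  change ((Module.finrank K (peirce K (e a) (e b)) : ℕ) : ℤ) = 0
  rw [this, finrank_bot, Nat.cast_zero]

/-- The matrix is block triangular with respect to the rank. Distinct idempotents of equal rank have
zero component, so each diagonal block is an identity matrix. -/
theorem IsDirected.det_dimMatrix [DecidableEq n] (h : IsDirected K e r) :
    (dimMatrix K e).det = 1 := by
  have htri : (dimMatrix K e).BlockTriangular r := fun a b hab =>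
    h.dimMatrix_eq_zero (fun h0 => by rw [h0] at hab; exact lt_irrefl _ hab) hab.le
  rw [htri.det]
  refine Finset.prod_eq_one fun k _ => ?_
  have : (dimMatrix K e).toSquareBlock r k = 1 := by
    ext a b
    by_cases hab : a = b
    · subst hab
      rw [Matrix.one_apply_eq]
      exact congrArg Nat.cast (h.finrank_peirce_self a.1)
    · rw [Matrix.one_apply_ne hab]
      exact h.dimMatrix_eq_zero (fun h0 => hab (Subtype.ext h0)) (b.2.trans a.2.symm).le
  rw [this, Matrix.det_one]

theorem IsDirected.coxeterPolynomial_eq_dimMatrix [DecidableEq n] (h : IsDirected K e r) :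
    coxeterPolynomial K A = coxeterDet (dimMatrix K e) := by
  rw [h.coxeterPolynomial_eq, ← coxeterDet_transpose]
  rfl

theorem IsDirected.natDegree_coxeterPolynomial (h : IsDirected K e r) :
    (coxeterPolynomial K A).natDegree = Fintype.card n := by
  classical
  rw [h.coxeterPolynomial_eq_dimMatrix, natDegree_coxeterDet h.det_dimMatrix]

end Directed

/-! ### The algebras of the tower -/

section Tower

variable {K : Type u} [Field K] {Q : Type u} [Quiver.{u} Q] [Fintype Q]

noncomputable instance (v : Q) : Fintype (Deleted Q v) := by
  classical
  exact inferInstanceAs (Fintype {a : Q // a ≠ v})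

/-- The common Cartan matrices of the algebras in the tower. -/
noncomputable def towerMatrix (I : TwoSidedIdeal (PathAlgebra K Q)) (v : Q) (i : ℕ) :
    Matrix (Deleted Q v ⊕ Fin i) (Deleted Q v ⊕ Fin i) ℤ :=
  chainMatrix (fun a b => dimMatrix K (idem I) a.1 b.1) (fun a => dimMatrix K (idem I) a.1 v)
    (fun b => dimMatrix K (idem I) v b.1) i

/-- A vertex of `Q` is different from `v` or equal to `v`. -/
noncomputable def deletedSumEquiv (v : Q) : Deleted Q v ⊕ Fin 1 ≃ Q :=
  Equiv.ofBijective (Sum.elim Subtype.val fun _ => v) <| by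
    constructor
    · rintro (a | s) (b | t) h
      · exact congrArg Sum.inl (Subtype.ext h)
      · exact absurd h a.2
      · exact absurd h.symm b.2
      · exact congrArg Sum.inr (Subsingleton.elim s t)
    · intro a
      by_cases ha : a = v
      · exact ⟨Sum.inr 0, ha.symm⟩
      · exact ⟨Sum.inl ⟨a, ha⟩, rfl⟩

theorem isDirected_minus (hQ : IsAcyclic Q) {I : TwoSidedIdeal (PathAlgebra K Q)}
    (hI : IsRelationIdeal I) (v : Q) : IsDirected K (A := Minus I v) (n := Deleted Q v)
      ((isDirected_idem hQ hI).cornerIdem (isIdempotentElem_idem I v).one_sub)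
      (fun a => pathRank a.1) := by
  classical
  exact ((isDirected_idem hQ hI).corner (isIdempotentElem_idem I v).one_sub).reindex
    (Equiv.refl (Deleted Q v))

theorem exists_isDirected_tower (hQ : IsAcyclic Q) {I : TwoSidedIdeal (PathAlgebra K Q)}
    (hI : IsRelationIdeal I) (v : Q) (i : ℕ) :
    ∃ (e : Deleted Q v ⊕ Fin i → tower I v i) (r : Deleted Q v ⊕ Fin i → ℤ),
      IsDirected K e r ∧ dimMatrix K e = towerMatrix I v i := by
  have h := isDirected_idem hQ hI
  match i with
  | 0 =>
    refine ⟨_, _, (isDirected_minus hQ hI v).reindex (Equiv.sumEmpty (Deleted Q v) (Fin 0)), ?_⟩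
    ext x y
    rcases x with a | s
    · rcases y with b | t
      · exact congrArg Nat.cast
          (h.finrank_peirce_corner (isIdempotentElem_idem I v).one_sub a b)
      · exact t.elim0
    · exact s.elim0
  | 1 =>
    refine ⟨_, _, h.reindex (deletedSumEquiv v), ?_⟩
    ext x y
    rcases x with a | s
    · rcases y with b | t <;> rfl
    · rcases y with b | t
      · rfl
      · refine Eq.trans ?_ (if_pos (Subsingleton.elim s t).le).symm
        exact congrArg Nat.cast (h.finrank_peirce_self v)
  -- Collapsing reduces each entry to one for `Λ`. Two elements of the chain in increasing order
  -- give the dimension of `e v Λ e v`, which is `1`; in decreasing order there is no path.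
  | i + 2 =>
    have hins := isDirected_idem (isAcyclic_insVertex (v := v) (k := i + 1) hQ)
      (isRelationIdeal_insIdeal hQ hI)
    refine ⟨_, _, hins.reindex (Equiv.refl (InsVertex Q v (Fin (i + 1 + 1)))), ?_⟩
    ext x y
    rcases x with a | s
    · rcases y with b | t
      · exact congrArg Nat.cast (finrank_peirce_insIdeal hQ hI (x := .old a) (y := .old b)
          (by rintro _ _ ⟨⟩))
      · exact congrArg Nat.cast (finrank_peirce_insIdeal hQ hI (x := .old a) (y := .new t)
          (by rintro _ _ ⟨⟩))
    · rcases y with b | t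
      · exact congrArg Nat.cast (finrank_peirce_insIdeal hQ hI (x := .new s) (y := .old b)
          (by rintro _ _ _ ⟨⟩))
      · by_cases hst : s ≤ t
        · refine Eq.trans ?_ (if_pos hst).symm
          refine congrArg Nat.cast ((finrank_peirce_insIdeal hQ hI (x := .new s) (y := .new t)
            ?_).trans (h.finrank_peirce_self v))
          rintro s' t' hs ht
          obtain rfl : s = s' := Sum.inr_injective hs
          obtain rfl : t = t' := Sum.inr_injective ht
          exact hst
        · refine Eq.trans ?_ (if_neg hst).symm
          exact congrArg Nat.cast (finrank_peirce_insIdeal_of_lt hQ I (not_le.1 hst))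

theorem coxeterPolynomial_tower (hQ : IsAcyclic Q) {I : TwoSidedIdeal (PathAlgebra K Q)}
    (hI : IsRelationIdeal I) (v : Q) (i : ℕ) [DecidableEq (Deleted Q v)] :
    coxeterPolynomial K (tower I v i) = coxeterDet (towerMatrix I v i) := by
  obtain ⟨e, r, h, hM⟩ := exists_isDirected_tower hQ hI v i
  rw [h.coxeterPolynomial_eq_dimMatrix, hM]

theorem natDegree_coxeterPolynomial_tower (hQ : IsAcyclic Q) {I : TwoSidedIdeal (PathAlgebra K Q)}
    (hI : IsRelationIdeal I) (v : Q) (i : ℕ) :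
    (coxeterPolynomial K (tower I v i)).natDegree = Fintype.card (Deleted Q v) + i := by
  obtain ⟨e, r, h, -⟩ := exists_isDirected_tower hQ hI v i
  rw [h.natDegree_coxeterPolynomial, Fintype.card_sum, Fintype.card_fin]

theorem isTriangular_tower (hQ : IsAcyclic Q) [∀ a b : Q, Finite (a ⟶ b)]
    {I : TwoSidedIdeal (PathAlgebra K Q)} (hI : IsRelationIdeal I) (v : Q) (i : ℕ) :
    IsTriangular K (tower I v i) := by
  match i with
  | 0 =>
    have := finiteDimensional_quotAlg hQ I
    have : FiniteDimensional K (Minus I v) := finiteDimensional_corner _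
    -- Only the corner needs the abstract criterion; the other algebras are triangular by their own
    -- presentations.
    exact (isDirected_minus hQ hI v).isTriangular
  | 1 => exact ⟨Q, inferInstance, inferInstance, I, inferInstance, hQ, hI, ⟨AlgEquiv.refl⟩⟩
  | i + 2 =>
    exact ⟨InsVertex Q v (Fin (i + 1 + 1)), inferInstance, inferInstance, insIdeal I v _,
      finite_insArrow, isAcyclic_insVertex hQ, isRelationIdeal_insIdeal hQ hI, ⟨AlgEquiv.refl⟩⟩

end Tower

end TriangularAlgebra

theorem propositionp {K : Type u} [Field K] {Q : Type u} [Quiver.{u} Q] [Fintype Q]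
    [∀ a b : Q, Finite (a ⟶ b)] (hQ : TriangularAlgebra.IsAcyclic Q)
    (I : TwoSidedIdeal (TriangularAlgebra.PathAlgebra K Q))
    (hI : TriangularAlgebra.IsRelationIdeal I) (v : Q) :
    Nonempty (TriangularAlgebra.Insertion I v (Fin 1) ≃ₐ[K] TriangularAlgebra.QuotAlg I) ∧
    (∀ i : ℕ, TriangularAlgebra.IsTriangular K (TriangularAlgebra.tower I v i)) ∧
    (∀ i : ℕ,
      (TriangularAlgebra.coxeterPolynomial K (TriangularAlgebra.tower I v (i + 1))).natDegree =
        (TriangularAlgebra.coxeterPolynomial K (TriangularAlgebra.tower I v i)).natDegree + 1) ∧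
    (∀ i : ℕ,
      TriangularAlgebra.coxeterPolynomial K (TriangularAlgebra.tower I v (i + 2)) =
        (X + 1) * TriangularAlgebra.coxeterPolynomial K (TriangularAlgebra.tower I v (i + 1)) -
          X * TriangularAlgebra.coxeterPolynomial K (TriangularAlgebra.tower I v i)) := by
  classical
  refine ⟨TriangularAlgebra.nonempty_insertion_one_equiv hQ hI,
    TriangularAlgebra.isTriangular_tower hQ hI v, fun i => ?_, fun i => ?_⟩
  · simp only [TriangularAlgebra.natDegree_coxeterPolynomial_tower hQ hI, add_assoc]
  · simp only [TriangularAlgebra.coxeterPolynomial_tower hQ hI]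
    exact TriangularAlgebra.coxeterDet_chainMatrix _ _ _ i
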